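/- Let $K$ be a field, let $S=K[x_1,\dots,x_n]$ have the standard grading, and let $R=S/I$ be a complete intersection, i.e. $I=(f_1,\dots,f_p)$ where $f_1,\dots,f_p$ is a regular sequence of homogeneous polynomials, $\deg f_k=d_k$. Let $\beta_{i,j}=\dim_K \operatorname{Tor}^S_i(R,K)_j$ be the graded Betti numbers, $\beta_i=\sum_{j}\beta_{i,j}$ the total Betti numbers, and for $1\le i\le p$ let $M_i=\max\{j:\beta_{i,j}\ne 0\}$ and $m_i=\min\{j:\beta_{i,j}\neq 0\}$. We say that $R$ has a pure resolution if for every $i\ge 1$ there is at most one $j$ with $\beta_{i,j}\neq 0$, and that $I$ has a linear resolution if for some $k$ one has $\beta_{i,j}=0$ whenever $i\ge 1$ and $j\ne k+i-1$. Then for every $i\ge 0$ only finitely many $\beta_{i,j}$ are nonzero and $\beta_i=\binom{p}{i}$; $R$ has a pure resolution if and only if $d_1=\dots=d_p$; and the following hold. (i) For $i=1,\dots,p$, $$\beta_i\;\le\;\prod_{1\le j<i}\frac{M_j}{M_i-M_j}\cdot\prod_{i<j\le p}\frac{M_j}{M_j-M_i}\;\le\;\frac{1}{(i-1)!\,(p-i)!}\prod_{\substack{1\le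 j\le p\\ j\ne i}}M_j .$$ The first upper bound is equal to $\beta_i$ for all $i=1,\dots,p$ if and only if $R$ has a pure resolution. Both upper bounds are equal to $\beta_i$ for all $i=1,\dots,p$ if and only if $I$ has a linear resolution. (ii) For $i=1,\dots,p$, $$\beta_i\;\ge\;\prod_{1\le j<i}\frac{m_j}{m_i-m_j}\cdot\prod_{i<j\le p}\frac{m_j}{m_j-m_i}\;\ge\;\prod_{1\le j<i}\frac{m_j}{M_i-m_j}\cdot\prod_{i<j\le p}\frac{m_j}{M_j-m_i}.$$ The first lower bound is equal to $\beta_i$ for all $i=1,\dots,p$ if and only if $R$ has a pure resolution, and the same is true of the second lower bound. -/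

import Mathlib

open MvPolynomial

namespace BettiCI

/-- A polynomial all of whose monomials have (standard) total degree equal to the integer `e`.
For `e < 0` this forces the polynomial to be zero. -/
def IsHomogeneousOfDegree {K : Type*} [Field K] {n : ℕ}
    (g : MvPolynomial (Fin n) K) (e : ℤ) : Prop :=
  ∀ m ∈ g.support, ((m.degree : ℕ) : ℤ) = e

/-- A graded free resolution, by finitely generated graded free modules, of the graded module
`S ⧸ I`, where `S = K[x_1, …, x_n]` has the standard grading and `I` is a graded ideal:
`⋯ → F_2 → F_1 → F_0 → S ⧸ I → 0` with `F_i = ⨁_{a : ι i} S(-deg i a)`.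
The differential `F_{i+1} → F_i` is given by its matrix `d i`.  The resolution is not assumed
to be minimal. -/
structure GradedFreeResolution {K : Type*} [Field K] {n : ℕ}
    (I : Ideal (MvPolynomial (Fin n) K)) where
  /-- the index set of the homogeneous basis of `F_i` -/
  ι : ℕ → Type
  /-- `F_i` has finite rank -/
  fintype_ι : ∀ i, Fintype (ι i)
  /-- equality of basis indices is decidable -/
  decEq_ι : ∀ i, DecidableEq (ι i)
  /-- the degrees of the basis elements of `F_i` -/
  deg : ∀ i, ι i → ℤ
  /-- the matrix of the differential `F_{i+1} → F_i` -/
  d : ∀ i, Matrix (ι i) (ι (i + 1)) (MvPolynomial (Fin n) K)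
  /-- the augmentation `F_0 → S ⧸ I` -/
  aug : (ι 0 → MvPolynomial (Fin n) K) →ₗ[MvPolynomial (Fin n) K] (MvPolynomial (Fin n) K ⧸ I)
  /-- the differentials are homogeneous of degree zero -/
  d_homogeneous : ∀ i a b, IsHomogeneousOfDegree (d i a b) (deg (i + 1) b - deg i a)
  /-- the augmentation is homogeneous of degree zero -/
  aug_homogeneous : ∀ a, ∃ g : MvPolynomial (Fin n) K,
    IsHomogeneousOfDegree g (deg 0 a) ∧ aug (Pi.single a 1) = Ideal.Quotient.mk I g
  /-- exactness at `S ⧸ I` -/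
  aug_surjective : Function.Surjective aug
  /-- exactness at `F_0` -/
  exact_zero : Function.Exact (d 0).mulVecLin aug
  /-- exactness at `F_{i+1}` -/
  exact_succ : ∀ i, Function.Exact (d (i + 1)).mulVecLin (d i).mulVecLin

namespace GradedFreeResolution

variable {K : Type*} [Field K] {n : ℕ} {I : Ideal (MvPolynomial (Fin n) K)}

attribute [instance] GradedFreeResolution.fintype_ι GradedFreeResolution.decEq_ι

/-- The index set of the basis elements of degree `j` in `F_i`. They form a `K`-basis of the
degree `j` component of `F_i ⊗_S K`, where `K = S ⧸ (x_1, …, x_n)`. -/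
abbrev Idx (F : GradedFreeResolution I) (i : ℕ) (j : ℤ) : Type :=
  {a : F.ι i // F.deg i a = j}

/-- The degree `j` component of the differential `F_{i+1} ⊗_S K → F_i ⊗_S K`: its matrix consists
of the residue classes modulo `(x_1, …, x_n)` of the entries of `d i`. -/
noncomputable def tensorD (F : GradedFreeResolution I) (i : ℕ) (j : ℤ) :
    (F.Idx (i + 1) j → K) →ₗ[K] (F.Idx i j → K) :=
  (Matrix.of fun (a : F.Idx i j) (b : F.Idx (i + 1) j) =>
    constantCoeff (F.d i a.1 b.1)).mulVecLin

/-- The cycles of the complex `F ⊗_S K` in homological degree `i` and internal degree `j`. -/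
noncomputable def cycles (F : GradedFreeResolution I) :
    (i : ℕ) → (j : ℤ) → Submodule K (F.Idx i j → K)
  | 0, _ => ⊤
  | i + 1, j => LinearMap.ker (F.tensorD i j)

/-- The boundaries of the complex `F ⊗_S K` in homological degree `i` and internal degree `j`. -/
noncomputable def boundaries (F : GradedFreeResolution I) (i : ℕ) (j : ℤ) :
    Submodule K (F.Idx i j → K) :=
  LinearMap.range (F.tensorD i j)

/-- `Tor_i^S(S ⧸ I, K)_j`, computed as the homology of `F ⊗_S K`. -/
abbrev TorModule (F : GradedFreeResolution I) (i : ℕ) (j : ℤ) : Type _ :=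
  F.cycles i j ⧸ (F.boundaries i j).submoduleOf (F.cycles i j)

/-- `dim_K Tor_i^S(S ⧸ I, K)_j`, computed with the resolution `F`. -/
noncomputable def torDim (F : GradedFreeResolution I) (i : ℕ) (j : ℤ) : ℕ :=
  Module.finrank K (F.TorModule i j)

end GradedFreeResolution

variable {K : Type*} [Field K] {n : ℕ}

open Classical in
/-- The graded Betti number `β_{i,j}^S(S ⧸ I) = dim_K Tor_i^S(S ⧸ I, K)_j` of a graded ideal `I`.
As usual for a derived functor, `Tor` is computed with a chosen graded free resolution. (Such a
resolution exists for every graded ideal; the value `0` in the other case is a placeholder.) -/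
noncomputable def gradedBetti (I : Ideal (MvPolynomial (Fin n) K)) (i : ℕ) (j : ℤ) : ℕ :=
  if h : Nonempty (GradedFreeResolution I) then (Classical.choice h).torDim i j else 0

/-- The total Betti number `β_i^S(S ⧸ I) = ∑_j β_{i,j}^S(S ⧸ I)`. -/
noncomputable def totalBetti (I : Ideal (MvPolynomial (Fin n) K)) (i : ℕ) : ℕ :=
  ∑ᶠ j : ℤ, gradedBetti I i j

/-- The set of shifts in homological degree `i`. -/
def shifts (I : Ideal (MvPolynomial (Fin n) K)) (i : ℕ) : Set ℤ :=
  {j : ℤ | gradedBetti I i j ≠ 0}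

/-- The maximal shift `M_i = max {j : β_{i,j} ≠ 0}`. -/
noncomputable def maxShift (I : Ideal (MvPolynomial (Fin n) K)) (i : ℕ) : ℤ :=
  sSup (shifts I i)

/-- The minimal shift `m_i = min {j : β_{i,j} ≠ 0}`. -/
noncomputable def minShift (I : Ideal (MvPolynomial (Fin n) K)) (i : ℕ) : ℤ :=
  sInf (shifts I i)

/-- `S ⧸ I` has a pure resolution: there are numbers `e_1, e_2, …` such that the `i`-th module in
the minimal graded free resolution is a direct sum of copies of `S(-e_i)`, for all `i ≥ 1`. -/
def HasPureResolution (I : Ideal (MvPolynomial (Fin n) K)) : Prop :=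
  ∃ e : ℕ → ℤ, ∀ i, 1 ≤ i → ∀ j ∈ shifts I i, j = e i

/-- The proper graded ideal `I` has a linear resolution: for some `k`, the ideal `I` has a `k`-linear
resolution, that is, `β_{i,j}^S(S ⧸ I) = β_{i-1,j}^S(I)` vanishes for `i ≥ 1` unless
`j = k + (i - 1)`. -/
def HasLinearResolution (I : Ideal (MvPolynomial (Fin n) K)) : Prop :=
  ∃ k : ℤ, ∀ i, 1 ≤ i → ∀ j ∈ shifts I i, j = k + ((i : ℤ) - 1)

/-- `∏_{1 ≤ j < i} A_j / (A_i - A_j) * ∏_{i < j ≤ p} A_j / (A_j - A_i)`. -/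
def pureBound (A : ℕ → ℤ) (p i : ℕ) : ℚ :=
  (∏ j ∈ Finset.Ico 1 i, (A j : ℚ) / ((A i : ℚ) - (A j : ℚ))) *
    ∏ j ∈ Finset.Ioc i p, (A j : ℚ) / ((A j : ℚ) - (A i : ℚ))

/-- `1 / ((i - 1)! (p - i)!) * ∏_{j ≠ i} M_j`, the product over `1 ≤ j ≤ p`. -/
def factorialUpperBound (M : ℕ → ℤ) (p i : ℕ) : ℚ :=
  1 / (((i - 1).factorial : ℚ) * ((p - i).factorial : ℚ)) *
    ∏ j ∈ (Finset.Icc 1 p).erase i, (M j : ℚ)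

/-- `∏_{1 ≤ j < i} m_j / (M_i - m_j) * ∏_{i < j ≤ p} m_j / (M_j - m_i)`. -/
def quasiPureLowerBound (m M : ℕ → ℤ) (p i : ℕ) : ℚ :=
  (∏ j ∈ Finset.Ico 1 i, (m j : ℚ) / ((M i : ℚ) - (m j : ℚ))) *
    ∏ j ∈ Finset.Ioc i p, (m j : ℚ) / ((M j : ℚ) - (m i : ℚ))

end BettiCI

/-!
The Betti numbers are computed from an explicit minimal resolution. Multiplication by a homogeneous
element `g` that is regular on `S ⧸ I` turns a graded free resolution of `S ⧸ I` into one of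
`S ⧸ (I + (g))`, the mapping cone (`GradedFreeResolution.cone`). If the given resolution has `r_{i,j}`
basis elements of degree `j` in homological degree `i`, then the cone has
`r_{i+1,j} + r_{i,j - deg g}` of them in homological degree `i + 1`. Iterating this along
`f_1, …, f_p` gives the Koszul complex (`exists_isMinimal`), whose entries lie in `(x_1, …, x_n)`.
`Tor` may be computed with any graded free resolution (`gradedBetti_eq_torDim`): two lifts of the
identity of `S ⧸ I` are homotopic, and a lift may be replaced by its degree-preserving part. Hence
`β_{i,j}` is the number of `i`-element subsets `s` of the generators with `∑_{k ∈ s} d_k = j`; in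
particular `β_i = p.choose i`, and `M_i` and `m_i` are the largest and the smallest sum of `i` of
the degrees.

Averaging over the `i`-element subsets of an extremal `(i+1)`-element set shows that `M_j / j` is
antitone and `m_j / j` is monotone. The expression `pureBound A p i` equals `p.choose i` for
`A_j = j`, and each of its factors is monotone in `A` for the order that compares the
ratios `A_j / A_k`, `j < k` (`pureBound_le_pureBound`). This gives the bounds by `M` and by `m`. If
one of them is attained for `i = 1`, all its factors agree with those for `A_j = j`, so
`M_p = p M_1` or `m_p = p m_1`, and then all `d_k` are equal, because `M_p = m_p = ∑ d_k`. The remaining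
inequalities hold factor by factor, since `M_k - M_j ≥ k - j` and `m_j ≤ M_j`.
-/

namespace BettiCI

variable {K : Type*} [Field K] {n : ℕ}

/-! ### Homogeneous parts of matrices -/

/-- The homogeneous component of `g` in the integer degree `e`; it is `0` for `e < 0`. -/
noncomputable def intComponent (e : ℤ) (g : MvPolynomial (Fin n) K) : MvPolynomial (Fin n) K :=
  if 0 ≤ e then homogeneousComponent e.toNat g else 0

lemma coeff_intComponent (e : ℤ) (g : MvPolynomial (Fin n) K) (m : Fin n →₀ ℕ) :
    coeff m (intComponent e g) = if ((m.degree : ℕ) : ℤ) = e then coeff m g else 0 := by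
  unfold intComponent
  split_ifs with h1 h2 h2
  · rw [coeff_homogeneousComponent, if_pos (by omega)]
  · rw [coeff_homogeneousComponent, if_neg (by omega)]
  · omega
  · simp

lemma isHomogeneousOfDegree_intComponent (e : ℤ) (g : MvPolynomial (Fin n) K) :
    IsHomogeneousOfDegree (intComponent e g) e := by
  intro m hm
  rw [mem_support_iff, coeff_intComponent] at hm
  by_contra h
  simp [h] at hm

lemma intComponent_eq_self {e : ℤ} {g : MvPolynomial (Fin n) K}
    (hg : IsHomogeneousOfDegree g e) : intComponent e g = g := by
  ext m
  rw [coeff_intComponent]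
  split_ifs with h
  · rfl
  · by_contra hne
    exact h (hg m (mem_support_iff.2 (Ne.symm hne)))

lemma intComponent_sum {α : Type*} (e : ℤ) (s : Finset α) (g : α → MvPolynomial (Fin n) K) :
    intComponent e (∑ a ∈ s, g a) = ∑ a ∈ s, intComponent e (g a) := by
  unfold intComponent
  split_ifs <;> simp

lemma intComponent_sub (e : ℤ) (g h : MvPolynomial (Fin n) K) :
    intComponent e (g - h) = intComponent e g - intComponent e h := by
  unfold intComponent
  split_ifs <;> simp

lemma intComponent_mul {e : ℤ} {g : MvPolynomial (Fin n) K} (hg : IsHomogeneousOfDegree g e)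
    (c : ℤ) (h : MvPolynomial (Fin n) K) :
    intComponent c (g * h) = g * intComponent (c - e) h := by
  ext m
  have key : ∀ x ∈ Finset.HasAntidiagonal.antidiagonal m,
      coeff x.1 g * coeff x.2 (intComponent (c - e) h) =
        if ((m.degree : ℕ) : ℤ) = c then coeff x.1 g * coeff x.2 h else 0 := by
    intro x hx
    rw [coeff_intComponent]
    have hm : x.1.degree + x.2.degree = m.degree := by
      rw [← map_add, Finset.HasAntidiagonal.mem_antidiagonal.1 hx]
    by_cases h0 : coeff x.1 g = 0
    · simp [h0]
    · have := hg x.1 (mem_support_iff.2 h0)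
      by_cases h1 : ((m.degree : ℕ) : ℤ) = c
      · rw [if_pos h1, if_pos (by omega)]
      · rw [if_neg h1, if_neg (by omega), mul_zero]
  rw [coeff_intComponent, coeff_mul, coeff_mul, Finset.sum_congr rfl key]
  split_ifs <;> simp

/-- An ideal generated by homogeneous polynomials is a graded ideal. -/
lemma intComponent_mem_span {ι : Type*} [Fintype ι] {f : ι → MvPolynomial (Fin n) K} {d : ι → ℤ}
    (hf : ∀ k, IsHomogeneousOfDegree (f k) (d k)) {h : MvPolynomial (Fin n) K}
    (hh : h ∈ Ideal.span (Set.range f)) (e : ℤ) :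
    intComponent e h ∈ Ideal.span (Set.range f) := by
  obtain ⟨c, rfl⟩ := (Submodule.mem_span_range_iff_exists_fun _).1 hh
  rw [intComponent_sum]
  refine Ideal.sum_mem _ fun k _ => ?_
  rw [smul_eq_mul, mul_comm, intComponent_mul (hf k)]
  exact Ideal.mul_mem_right _ _ (Ideal.subset_span ⟨k, rfl⟩)

/-- `A` is the matrix of a degree-preserving map `⨁_b S(-dβ b) → ⨁_a S(-dα a)`. -/
def IsGradedMatrix {α β : Type*} (dα : α → ℤ) (dβ : β → ℤ)
    (A : Matrix α β (MvPolynomial (Fin n) K)) : Prop :=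
  ∀ a b, IsHomogeneousOfDegree (A a b) (dβ b - dα a)

/-- The degree-preserving part of a matrix between graded free modules with basis degrees `dα`
and `dβ`. -/
noncomputable def gradedPart {α β : Type*} (dα : α → ℤ) (dβ : β → ℤ)
    (A : Matrix α β (MvPolynomial (Fin n) K)) : Matrix α β (MvPolynomial (Fin n) K) :=
  Matrix.of fun a b => intComponent (dβ b - dα a) (A a b)

section Matrices

variable {α β γ : Type*} {dα : α → ℤ} {dβ : β → ℤ} {dγ : γ → ℤ}

lemma isGradedMatrix_gradedPart (A : Matrix α β (MvPolynomial (Fin n) K)) :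
    IsGradedMatrix dα dβ (gradedPart dα dβ A) :=
  fun _ _ => isHomogeneousOfDegree_intComponent _ _

lemma gradedPart_mul_of_left [Fintype β] {A : Matrix α β (MvPolynomial (Fin n) K)}
    (hA : IsGradedMatrix dα dβ A) (B : Matrix β γ (MvPolynomial (Fin n) K)) :
    gradedPart dα dγ (A * B) = A * gradedPart dβ dγ B := by
  ext1 a c
  simp only [gradedPart, Matrix.of_apply, Matrix.mul_apply, intComponent_sum]
  refine Finset.sum_congr rfl fun b _ => ?_
  rw [intComponent_mul (hA a b)]
  congr 2
  ring

lemma gradedPart_mul_of_right [Fintype β] (A : Matrix α β (MvPolynomial (Fin n) K))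
    {B : Matrix β γ (MvPolynomial (Fin n) K)} (hB : IsGradedMatrix dβ dγ B) :
    gradedPart dα dγ (A * B) = gradedPart dα dβ A * B := by
  ext1 a c
  simp only [gradedPart, Matrix.of_apply, Matrix.mul_apply, intComponent_sum]
  refine Finset.sum_congr rfl fun b _ => ?_
  rw [mul_comm, intComponent_mul (hB b c), mul_comm]
  congr 2
  ring

/-- The degree `j` component of `A ⊗_S K`, for a matrix `A` between graded free modules. -/
noncomputable def residueBlock (dα : α → ℤ) (dβ : β → ℤ) (j : ℤ)
    (A : Matrix α β (MvPolynomial (Fin n) K)) : Matrix {a // dα a = j} {b // dβ b = j} K :=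
  Matrix.of fun a b => constantCoeff (A a.1 b.1)

lemma IsGradedMatrix.constantCoeff_eq_zero {A : Matrix α β (MvPolynomial (Fin n) K)}
    (hA : IsGradedMatrix dα dβ A) {a : α} {b : β} (h : dβ b ≠ dα a) :
    constantCoeff (A a b) = 0 := by
  by_contra h0
  have := hA a b 0 (mem_support_iff.2 h0)
  simp only [map_zero, Nat.cast_zero] at this
  omega

/-- Taking the degree `j` component of the reduction modulo `(x_1, …, x_n)` is multiplicative if no
product passes through a basis element of a degree other than `j`. -/
lemma residueBlock_mul_of_forall_eq_zero [Fintype β] (j : ℤ)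
    {A : Matrix α β (MvPolynomial (Fin n) K)}
    {B : Matrix β γ (MvPolynomial (Fin n) K)}
    (h : ∀ a b c, dα a = j → dγ c = j → dβ b ≠ j →
      constantCoeff (A a b) * constantCoeff (B b c) = 0) :
    residueBlock dα dγ j (A * B) = residueBlock dα dβ j A * residueBlock dβ dγ j B := by
  ext1 a c
  simp only [residueBlock, Matrix.of_apply, Matrix.mul_apply, map_sum, map_mul]
  rw [← Fintype.sum_subtype_add_sum_subtype (fun b => dβ b = j)
    (fun b => constantCoeff (A a.1 b) * constantCoeff (B b c.1)),
    Fintype.sum_eq_zero (fun b : {b // ¬ dβ b = j} =>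
      constantCoeff (A a.1 b) * constantCoeff (B b c.1)) fun b => h _ _ _ a.2 c.2 b.2, add_zero]

lemma residueBlock_mul_of_left [Fintype β] (j : ℤ) {A : Matrix α β (MvPolynomial (Fin n) K)}
    (hA : IsGradedMatrix dα dβ A) (B : Matrix β γ (MvPolynomial (Fin n) K)) :
    residueBlock dα dγ j (A * B) = residueBlock dα dβ j A * residueBlock dβ dγ j B :=
  residueBlock_mul_of_forall_eq_zero j fun a b c ha _ hb => by
    rw [hA.constantCoeff_eq_zero (by rw [ha]; exact hb), zero_mul]

lemma residueBlock_mul_of_right [Fintype β] (j : ℤ) (A : Matrix α β (MvPolynomial (Fin n) K))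
    {B : Matrix β γ (MvPolynomial (Fin n) K)} (hB : IsGradedMatrix dβ dγ B) :
    residueBlock dα dγ j (A * B) = residueBlock dα dβ j A * residueBlock dβ dγ j B :=
  residueBlock_mul_of_forall_eq_zero j fun a b c _ hc hb => by
    rw [hB.constantCoeff_eq_zero (by rw [hc]; exact hb.symm), mul_zero]

lemma residueBlock_add (j : ℤ) (A B : Matrix α β (MvPolynomial (Fin n) K)) :
    residueBlock dα dβ j (A + B) = residueBlock dα dβ j A + residueBlock dα dβ j B := by
  ext; simp [residueBlock]

lemma residueBlock_one [DecidableEq α] (j : ℤ) :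
    residueBlock dα dα j (1 : Matrix α α (MvPolynomial (Fin n) K)) = 1 := by
  ext a b
  by_cases h : a = b
  · subst h
    simp [residueBlock]
  · have : a.1 ≠ b.1 := fun h' => h (Subtype.ext h')
    simp [residueBlock, h, Matrix.one_apply_ne this]

end Matrices

/-! ### Comparison of graded free resolutions -/

/-- Dependent choice along `ℕ`. -/
lemma exists_seq_of_forall_exists {α : ℕ → Type*} (P : ∀ i, α i → Prop)
    (R : ∀ i, α i → α (i + 1) → Prop) (h0 : ∃ x, P 0 x)
    (hs : ∀ i x, P i x → ∃ y, P (i + 1) y ∧ R i x y) :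
    ∃ x : ∀ i, α i, P 0 (x 0) ∧ ∀ i, R i (x i) (x (i + 1)) := by
  choose g hg hR using hs
  obtain ⟨x0, hx0⟩ := h0
  let x : ∀ i, {x : α i // P i x} := fun i =>
    Nat.rec ⟨x0, hx0⟩ (fun i x => ⟨g i x.1 x.2, hg i x.1 x.2⟩) i
  exact ⟨fun i => (x i).1, hx0, fun i => hR i _ (x i).2⟩

namespace GradedFreeResolution

variable {I : Ideal (MvPolynomial (Fin n) K)}

lemma isGradedMatrix_d (F : GradedFreeResolution I) (i : ℕ) :
    IsGradedMatrix (F.deg i) (F.deg (i + 1)) (F.d i) :=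
  F.d_homogeneous i

lemma d_mul_d (F : GradedFreeResolution I) (i : ℕ) : F.d i * F.d (i + 1) = 0 := by
  apply Matrix.toLin'.injective
  have := (F.exact_succ i).linearMap_comp_eq_zero
  rw [Matrix.toLin'_mul, map_zero]
  exact this

lemma aug_comp_d (F : GradedFreeResolution I) : F.aug ∘ₗ (F.d 0).mulVecLin = 0 :=
  F.exact_zero.linearMap_comp_eq_zero

lemma exists_d_succ_mul_eq (F : GradedFreeResolution I) (i : ℕ) {β : Type*}
    (A : Matrix (F.ι (i + 1)) β (MvPolynomial (Fin n) K)) (h : F.d i * A = 0) :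
    ∃ B, F.d (i + 1) * B = A := by
  have : ∀ b, ∃ v, (F.d (i + 1)).mulVecLin v = A.col b := fun b => by
    refine (F.exact_succ i (A.col b)).1 ?_
    ext1 a
    exact congrFun (congrFun h a) b
  choose v hv using this
  refine ⟨Matrix.of fun a b => v b a, ?_⟩
  ext1 a b
  exact congrFun (hv b) a

lemma exists_d_zero_mul_eq (F : GradedFreeResolution I) {β : Type*} [Fintype β]
    (A : Matrix (F.ι 0) β (MvPolynomial (Fin n) K)) (h : F.aug ∘ₗ A.mulVecLin = 0) :
    ∃ B, F.d 0 * B = A := by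
  classical
  have : ∀ b, ∃ v, (F.d 0).mulVecLin v = A.col b := fun b => by
    refine (F.exact_zero (A.col b)).1 ?_
    have := LinearMap.congr_fun h (Pi.single b 1)
    simpa using this
  choose v hv using this
  refine ⟨Matrix.of fun a b => v b a, ?_⟩
  ext1 a b
  exact congrFun (hv b) a

/-- The identity of `S ⧸ I` lifts to a chain map between two free resolutions. -/
lemma exists_lift (F G : GradedFreeResolution I) :
    ∃ φ : ∀ i, Matrix (G.ι i) (F.ι i) (MvPolynomial (Fin n) K),
      G.aug ∘ₗ (φ 0).mulVecLin = F.aug ∧ ∀ i, G.d i * φ (i + 1) = φ i * F.d i := by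
  have h0 : ∃ A : Matrix (G.ι 0) (F.ι 0) (MvPolynomial (Fin n) K),
      G.aug ∘ₗ A.mulVecLin = F.aug := by
    choose v hv using fun b => G.aug_surjective (F.aug (Pi.single b 1))
    refine ⟨Matrix.of fun a b => v b a, LinearMap.pi_ext' fun b => LinearMap.ext_ring ?_⟩
    simp only [LinearMap.comp_apply, LinearMap.single_apply, Matrix.mulVecLin_apply,
      Matrix.mulVec_single_one]
    exact hv b
  let P : ∀ i, Matrix (G.ι i) (F.ι i) (MvPolynomial (Fin n) K) → Prop
    | 0, A => G.aug ∘ₗ A.mulVecLin = F.aug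
    | i + 1, A => G.d i * (A * F.d (i + 1)) = 0
  refine exists_seq_of_forall_exists
    (α := fun i => Matrix (G.ι i) (F.ι i) (MvPolynomial (Fin n) K)) P
    (fun i A B => G.d i * B = A * F.d i) h0 fun i A hA => ?_
  have : ∃ B : Matrix (G.ι (i + 1)) (F.ι (i + 1)) (MvPolynomial (Fin n) K),
      G.d i * B = A * F.d i := by
    cases i with
    | zero =>
      refine G.exists_d_zero_mul_eq _ ?_
      rw [Matrix.mulVecLin_mul, ← LinearMap.comp_assoc, show _ = _ from hA, F.aug_comp_d]
    | succ i => exact G.exists_d_succ_mul_eq i _ hA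
  obtain ⟨B, hB⟩ := this
  refine ⟨B, ?_, hB⟩
  change G.d i * (B * F.d (i + 1)) = 0
  rw [← Matrix.mul_assoc, hB, Matrix.mul_assoc, F.d_mul_d, Matrix.mul_zero]

/-- Two lifts of the identity of `S ⧸ I` are chain homotopic. -/
lemma exists_homotopy (F G : GradedFreeResolution I)
    (θ : ∀ i, Matrix (G.ι i) (F.ι i) (MvPolynomial (Fin n) K))
    (h0 : G.aug ∘ₗ (θ 0).mulVecLin = 0) (hθ : ∀ i, G.d i * θ (i + 1) = θ i * F.d i) :
    ∃ h : ∀ i, Matrix (G.ι (i + 1)) (F.ι i) (MvPolynomial (Fin n) K),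
      G.d 0 * h 0 = θ 0 ∧ ∀ i, G.d (i + 1) * h (i + 1) + h i * F.d i = θ (i + 1) := by
  obtain ⟨B, hB⟩ := G.exists_d_zero_mul_eq _ h0
  let P : ∀ i, Matrix (G.ι (i + 1)) (F.ι i) (MvPolynomial (Fin n) K) → Prop
    | 0, A => G.d 0 * A = θ 0
    | i + 1, A => G.d (i + 1) * (θ (i + 2) - A * F.d (i + 1)) = 0
  refine exists_seq_of_forall_exists
    (α := fun i => Matrix (G.ι (i + 1)) (F.ι i) (MvPolynomial (Fin n) K)) P
    (fun i A B => G.d (i + 1) * B + A * F.d i = θ (i + 1)) ⟨B, hB⟩ fun i A hA => ?_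
  have hA' : G.d i * (θ (i + 1) - A * F.d i) = 0 := by
    cases i with
    | zero => rw [Matrix.mul_sub, ← Matrix.mul_assoc, show G.d 0 * A = θ 0 from hA, hθ, sub_self]
    | succ i => exact hA
  obtain ⟨C, hC⟩ : ∃ C : Matrix (G.ι (i + 2)) (F.ι (i + 1)) (MvPolynomial (Fin n) K),
      G.d (i + 1) * C = θ (i + 1) - A * F.d i := G.exists_d_succ_mul_eq i _ hA'
  have hC' : G.d (i + 1) * C + A * F.d i = θ (i + 1) := by rw [hC, sub_add_cancel]
  refine ⟨C, ?_, hC'⟩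
  change G.d (i + 1) * (θ (i + 2) - C * F.d (i + 1)) = 0
  rw [Matrix.mul_sub, hθ, ← Matrix.mul_assoc, ← hC', Matrix.add_mul, Matrix.mul_assoc A,
    F.d_mul_d, Matrix.mul_zero, add_zero, sub_self]

/-- The lift of the identity of `S ⧸ I` can be chosen degree-preserving: take the degree-preserving
part of any lift. -/
lemma exists_graded_lift (hI : ∀ g ∈ I, ∀ e, intComponent e g ∈ I)
    (F G : GradedFreeResolution I) :
    ∃ φ : ∀ i, Matrix (G.ι i) (F.ι i) (MvPolynomial (Fin n) K),
      G.aug ∘ₗ (φ 0).mulVecLin = F.aug ∧ (∀ i, G.d i * φ (i + 1) = φ i * F.d i) ∧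
      ∀ i, IsGradedMatrix (G.deg i) (F.deg i) (φ i) := by
  obtain ⟨φ, h0, hφ⟩ := exists_lift F G
  refine ⟨fun i => gradedPart (G.deg i) (F.deg i) (φ i), ?_, fun i => ?_,
    fun i => isGradedMatrix_gradedPart _⟩
  · choose g hg hGg using G.aug_homogeneous
    choose f hf hFf using F.aug_homogeneous
    have haug (A : Matrix (G.ι 0) (F.ι 0) (MvPolynomial (Fin n) K)) (b : F.ι 0) :
        G.aug (A.col b) = Ideal.Quotient.mk I (∑ a, A a b * g a) := by
      have : A.col b = ∑ a, A a b • Pi.single a 1 := by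
        ext1 a
        simp [Pi.single_apply]
      rw [this, map_sum, map_sum]
      refine Finset.sum_congr rfl fun a _ => ?_
      rw [map_smul, hGg, map_mul]
      rfl
    refine LinearMap.pi_ext' fun b => LinearMap.ext_ring ?_
    have h1 := LinearMap.congr_fun h0 (Pi.single b 1)
    simp only [LinearMap.comp_apply, LinearMap.single_apply, Matrix.mulVecLin_apply,
      Matrix.mulVec_single_one] at h1 ⊢
    rw [haug, hFf, Ideal.Quotient.eq] at h1 ⊢
    have h2 : intComponent (F.deg 0 b) (∑ a, φ 0 a b * g a - f b) ∈ I := hI _ h1 _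
    rw [intComponent_sub, intComponent_eq_self (hf b), intComponent_sum] at h2
    convert h2 using 3 with a
    rw [mul_comm, mul_comm _ (g a), intComponent_mul (hg a)]
    rfl
  · rw [← gradedPart_mul_of_left (G.isGradedMatrix_d i), hφ,
      gradedPart_mul_of_right _ (F.isGradedMatrix_d i)]

/-! ### Independence of the resolution -/

/-- A linear map that induces an injection `Z ⧸ B → Z' ⧸ B'` of subquotients. -/
lemma finrank_quotient_le {V W : Type*} [AddCommGroup V] [Module K V] [AddCommGroup W]
    [Module K W] [FiniteDimensional K W] (f : V →ₗ[K] W) (Z B : Submodule K V)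
    (Z' B' : Submodule K W) (hZ : ∀ z ∈ Z, f z ∈ Z') (hB : ∀ b ∈ B, f b ∈ B')
    (hinj : ∀ z ∈ Z, f z ∈ B' → z ∈ B) :
    Module.finrank K (Z ⧸ B.submoduleOf Z) ≤ Module.finrank K (Z' ⧸ B'.submoduleOf Z') := by
  refine LinearMap.finrank_le_finrank_of_injective
    (f := Submodule.mapQ (B.submoduleOf Z) (B'.submoduleOf Z') (f.restrict hZ)
      fun z hz => hB z.1 hz) ?_
  rw [← LinearMap.ker_eq_bot, LinearMap.ker_eq_bot']
  intro q
  induction q using Submodule.Quotient.induction_on with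
  | H z =>
    intro hz
    replace hz := (Submodule.Quotient.mk_eq_zero _).1 hz
    rw [Submodule.Quotient.mk_eq_zero]
    exact hinj z.1 z.2 hz

/-- A composite of degree-preserving lifts `F → G → F` is homotopic to the identity, so `F → G` is
injective on homology after tensoring with `K`. -/
lemma torDim_le (hI : ∀ g ∈ I, ∀ e, intComponent e g ∈ I)
    (F G : GradedFreeResolution I) (i : ℕ) (j : ℤ) : F.torDim i j ≤ G.torDim i j := by
  obtain ⟨φ, hφ0, hφ, hφg⟩ := exists_graded_lift hI F G
  obtain ⟨ψ, hψ0, hψ, hψg⟩ := exists_graded_lift hI G F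
  obtain ⟨h, h0, hs⟩ := exists_homotopy F F (fun i => ψ i * φ i - 1)
    (by
      have : (ψ 0 * φ 0 - 1).mulVecLin = (ψ 0).mulVecLin ∘ₗ (φ 0).mulVecLin - LinearMap.id :=
        LinearMap.ext fun v => by simp
      rw [this, LinearMap.comp_sub, ← LinearMap.comp_assoc, hψ0, hφ0, LinearMap.comp_id,
        sub_self])
    (fun i => by
      rw [Matrix.mul_sub, ← Matrix.mul_assoc, hψ, Matrix.mul_assoc, hφ, Matrix.sub_mul,
        Matrix.mul_assoc, Matrix.mul_one, Matrix.one_mul])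
  -- the residue blocks of the chain maps and of the homotopy
  let φ' := fun i => residueBlock (G.deg i) (F.deg i) j (φ i)
  let ψ' := fun i => residueBlock (F.deg i) (G.deg i) j (ψ i)
  let dF := fun i => residueBlock (F.deg i) (F.deg (i + 1)) j (F.d i)
  let dG := fun i => residueBlock (G.deg i) (G.deg (i + 1)) j (G.d i)
  let h' := fun i => residueBlock (F.deg (i + 1)) (F.deg i) j (h i)
  have hφ' (i : ℕ) : dG i * φ' (i + 1) = φ' i * dF i := by
    simp only [φ', dG, dF]
    rw [← residueBlock_mul_of_left j (G.isGradedMatrix_d i), hφ,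
      residueBlock_mul_of_right j _ (F.isGradedMatrix_d i)]
  have hψ' (i : ℕ) : dF i * ψ' (i + 1) = ψ' i * dG i := by
    simp only [ψ', dG, dF]
    rw [← residueBlock_mul_of_left j (F.isGradedMatrix_d i), hψ,
      residueBlock_mul_of_right j _ (G.isGradedMatrix_d i)]
  have hz' : ψ' 0 * φ' 0 = dF 0 * h' 0 + 1 := by
    simp only [φ', ψ', dF, h']
    rw [← residueBlock_mul_of_left j (F.isGradedMatrix_d 0), h0,
      ← residueBlock_mul_of_left j (hψg 0), ← residueBlock_one, ← residueBlock_add, sub_add_cancel]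
  have hs' (i : ℕ) : ψ' (i + 1) * φ' (i + 1) = dF (i + 1) * h' (i + 1) + h' i * dF i + 1 := by
    simp only [φ', ψ', dF, h']
    rw [← residueBlock_mul_of_left j (F.isGradedMatrix_d _),
      ← residueBlock_mul_of_right j _ (F.isGradedMatrix_d _), ← residueBlock_add, hs,
      ← residueBlock_mul_of_left j (hψg _), ← residueBlock_one, ← residueBlock_add, sub_add_cancel]
  refine finrank_quotient_le (φ' i).mulVecLin _ _ _ _ ?_ ?_ ?_
  · intro z hz
    cases i with
    | zero => exact Submodule.mem_top
    | succ i =>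
      change (dF i).mulVec z = 0 at hz
      change (dG i).mulVec ((φ' (i + 1)).mulVec z) = 0
      rw [Matrix.mulVec_mulVec, hφ', ← Matrix.mulVec_mulVec, hz, Matrix.mulVec_zero]
  · rintro _ ⟨w, rfl⟩
    refine ⟨(φ' (i + 1)).mulVec w, ?_⟩
    change (dG i).mulVec ((φ' (i + 1)).mulVec w) = (φ' i).mulVec ((dF i).mulVec w)
    rw [Matrix.mulVec_mulVec, hφ', Matrix.mulVec_mulVec]
  · rintro z hz ⟨w, hw⟩
    change (dG i).mulVec w = (φ' i).mulVec z at hw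
    have h1 : (dF i).mulVec ((ψ' (i + 1)).mulVec w) = (ψ' i * φ' i).mulVec z := by
      rw [Matrix.mulVec_mulVec, hψ', ← Matrix.mulVec_mulVec, hw, Matrix.mulVec_mulVec]
    have h2 : (ψ' i * φ' i).mulVec z = (dF i).mulVec ((h' i).mulVec z) + z := by
      cases i with
      | zero => rw [hz', Matrix.add_mulVec, Matrix.mulVec_mulVec, Matrix.one_mulVec]
      | succ i =>
        change (dF i).mulVec z = 0 at hz
        rw [hs', Matrix.add_mulVec, Matrix.add_mulVec, ← Matrix.mulVec_mulVec z (h' i), hz,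
          Matrix.mulVec_zero, add_zero, Matrix.mulVec_mulVec, Matrix.one_mulVec]
    refine ⟨(ψ' (i + 1)).mulVec w - (h' i).mulVec z, ?_⟩
    change (dF i).mulVec _ = z
    rw [Matrix.mulVec_sub, h1, h2, add_sub_cancel_left]

end GradedFreeResolution

/-- The graded Betti numbers can be computed with any graded free resolution. -/
lemma gradedBetti_eq_torDim {I : Ideal (MvPolynomial (Fin n) K)}
    (hI : ∀ g ∈ I, ∀ e, intComponent e g ∈ I) (F : GradedFreeResolution I)
    (i : ℕ) (j : ℤ) : gradedBetti I i j = F.torDim i j := by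
  rw [gradedBetti, dif_pos ⟨F⟩]
  exact le_antisymm (GradedFreeResolution.torDim_le hI _ _ i j)
    (GradedFreeResolution.torDim_le hI _ _ i j)

/-! ### The mapping cone of multiplication by a regular element -/

namespace GradedFreeResolution

variable {I : Ideal (MvPolynomial (Fin n) K)}

/-- A graded free resolution is minimal if its differentials vanish modulo `(x_1, …, x_n)`. -/
def IsMinimal (F : GradedFreeResolution I) : Prop :=
  ∀ i a b, constantCoeff (F.d i a b) = 0

lemma IsMinimal.torDim_eq {F : GradedFreeResolution I} (hF : F.IsMinimal) (i : ℕ) (j : ℤ) :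
    F.torDim i j = Fintype.card (F.Idx i j) := by
  have h0 (i : ℕ) : F.tensorD i j = 0 := by
    ext v a
    simp [tensorD, Matrix.mulVec, dotProduct, hF i]
  have hZ : F.cycles i j = ⊤ := by
    cases i with
    | zero => rfl
    | succ i => rw [cycles, h0, LinearMap.ker_zero]
  have hB : F.boundaries i j = ⊥ := by rw [boundaries, h0, LinearMap.range_zero]
  have key (Z B : Submodule K (F.Idx i j → K)) (hZ : Z = ⊤) (hB : B = ⊥) :
      Module.finrank K (Z ⧸ B.submoduleOf Z) = Fintype.card (F.Idx i j) := by
    subst hZ hB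
    have : (⊥ : Submodule K (F.Idx i j → K)).submoduleOf ⊤ = ⊥ := by
      simp [Submodule.submoduleOf]
    rw [(Submodule.quotEquivOfEqBot _ this).finrank_eq, finrank_top,
      Module.finrank_fintype_fun_eq_card]
  exact key _ _ hZ hB

/-- The basis of the mapping cone: `F_i ⊕ F_{i-1}(-e)` in homological degree `i`. -/
def coneι (F : GradedFreeResolution I) : ℕ → Type
  | 0 => F.ι 0
  | i + 1 => F.ι (i + 1) ⊕ F.ι i

instance fintypeConeι (F : GradedFreeResolution I) : ∀ i, Fintype (F.coneι i)
  | 0 => F.fintype_ι 0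
  | i + 1 => inferInstanceAs (Fintype (F.ι (i + 1) ⊕ F.ι i))

instance decidableEqConeι (F : GradedFreeResolution I) : ∀ i, DecidableEq (F.coneι i)
  | 0 => F.decEq_ι 0
  | i + 1 => inferInstanceAs (DecidableEq (F.ι (i + 1) ⊕ F.ι i))

/-- The degrees of the basis elements of `F_i ⊕ F_{i-1}(-e)`. -/
def coneDeg (F : GradedFreeResolution I) (e : ℤ) : ∀ i, F.coneι i → ℤ
  | 0 => F.deg 0
  | i + 1 => Sum.elim (F.deg (i + 1)) (fun a => F.deg i a + e)

/-- The differential `(u, w) ↦ d u + g w` of the mapping cone in homological degree `1`. -/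
noncomputable def coneDZero (F : GradedFreeResolution I) (g : MvPolynomial (Fin n) K) :
    Matrix (F.ι 0) (F.ι 1 ⊕ F.ι 0) (MvPolynomial (Fin n) K) :=
  Matrix.fromCols (F.d 0) (g • 1)

/-- The differential `(u, w) ↦ (d u + g w, - d w)` of the mapping cone in homological degrees
`≥ 2`. -/
noncomputable def coneDSucc (F : GradedFreeResolution I) (g : MvPolynomial (Fin n) K) (i : ℕ) :
    Matrix (F.ι (i + 1) ⊕ F.ι i) (F.ι (i + 2) ⊕ F.ι (i + 1)) (MvPolynomial (Fin n) K) :=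
  Matrix.fromBlocks (F.d (i + 1)) (g • 1) 0 (-(F.d i))

/-- The differential of the mapping cone. -/
noncomputable def coneD (F : GradedFreeResolution I) (g : MvPolynomial (Fin n) K) :
    ∀ i, Matrix (F.coneι i) (F.coneι (i + 1)) (MvPolynomial (Fin n) K)
  | 0 => F.coneDZero g
  | i + 1 => F.coneDSucc g i

lemma isHomogeneousOfDegree_zero (e : ℤ) :
    IsHomogeneousOfDegree (0 : MvPolynomial (Fin n) K) e := by
  intro m hm
  simp at hm

lemma isHomogeneousOfDegree_one : IsHomogeneousOfDegree (1 : MvPolynomial (Fin n) K) 0 := by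
  intro m hm
  have : m = 0 := by
    by_contra h
    rw [mem_support_iff, coeff_one, if_neg (Ne.symm h)] at hm
    exact hm rfl
  simp [this]

lemma IsHomogeneousOfDegree.neg {g : MvPolynomial (Fin n) K} {e : ℤ}
    (h : IsHomogeneousOfDegree g e) : IsHomogeneousOfDegree (-g) e := by
  intro m hm
  exact h m (by simpa using hm)

lemma isGradedMatrix_smul_one {α : Type*} [DecidableEq α] {g : MvPolynomial (Fin n) K} {e : ℤ}
    (hg : IsHomogeneousOfDegree g e) (dα : α → ℤ) :
    IsGradedMatrix dα (fun a => dα a + e) (g • (1 : Matrix α α (MvPolynomial (Fin n) K))) := by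
  intro a b
  by_cases h : a = b
  · subst h
    simpa using hg
  · simpa [Matrix.one_apply_ne h] using isHomogeneousOfDegree_zero _

lemma coneDZero_apply (F : GradedFreeResolution I) (g : MvPolynomial (Fin n) K)
    (v : F.ι 1 ⊕ F.ι 0 → MvPolynomial (Fin n) K) :
    (F.coneDZero g).mulVecLin v = (F.d 0).mulVecLin (v ∘ Sum.inl) + g • (v ∘ Sum.inr) := by
  rw [Matrix.mulVecLin_apply, coneDZero, Matrix.fromCols_mulVec,
    Matrix.smul_mulVec, Matrix.one_mulVec]
  rfl

lemma coneDSucc_apply (F : GradedFreeResolution I) (g : MvPolynomial (Fin n) K) (i : ℕ)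
    (v : F.ι (i + 2) ⊕ F.ι (i + 1) → MvPolynomial (Fin n) K) :
    (F.coneDSucc g i).mulVecLin v =
      Sum.elim ((F.d (i + 1)).mulVecLin (v ∘ Sum.inl) + g • (v ∘ Sum.inr))
        (-(F.d i).mulVecLin (v ∘ Sum.inr)) := by
  rw [Matrix.mulVecLin_apply, coneDSucc, Matrix.fromBlocks_mulVec,
    Matrix.smul_mulVec, Matrix.one_mulVec, Matrix.zero_mulVec,
    Matrix.neg_mulVec, zero_add]
  rfl

lemma d_d_apply (F : GradedFreeResolution I) (i : ℕ) (v) :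
    (F.d i).mulVecLin ((F.d (i + 1)).mulVecLin v) = 0 :=
  (F.exact_succ i _).2 ⟨v, rfl⟩

/-- Exactness of the mapping cone in homological degree `1`, where the regularity of `g` enters. -/
lemma cone_exact_one (F : GradedFreeResolution I) {g : MvPolynomial (Fin n) K}
    (hreg : ∀ x, g * x ∈ I → x ∈ I) :
    Function.Exact (F.coneDSucc g 0).mulVecLin (F.coneDZero g).mulVecLin := by
  intro v
  constructor
  · intro hv
    rw [coneDZero_apply] at hv
    have h1 : F.aug (v ∘ Sum.inr) = 0 := by
      have h2 : g • F.aug (v ∘ Sum.inr) = 0 := by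
        have := congrArg F.aug hv
        rwa [map_add, (F.exact_zero _).2 ⟨_, rfl⟩, zero_add, map_smul, map_zero] at this
      obtain ⟨x, hx⟩ := Ideal.Quotient.mk_surjective (F.aug (v ∘ Sum.inr))
      rw [← hx] at h2 ⊢
      exact Ideal.Quotient.eq_zero_iff_mem.2 (hreg x (Ideal.Quotient.eq_zero_iff_mem.1 h2))
    obtain ⟨w, hw⟩ := (F.exact_zero _).1 h1
    have h2 : (F.d 0).mulVecLin (v ∘ Sum.inl + g • w) = 0 := by
      rw [map_add, map_smul, hw, hv]
    obtain ⟨u, hu⟩ := (F.exact_succ 0 _).1 h2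
    refine ⟨Sum.elim u (-w), ?_⟩
    rw [coneDSucc_apply, Sum.elim_comp_inl, Sum.elim_comp_inr, map_neg, neg_neg, hu, hw, smul_neg,
      add_neg_cancel_right]
    exact Sum.elim_comp_inl_inr v
  · rintro ⟨u, rfl⟩
    rw [coneDZero_apply, coneDSucc_apply, Sum.elim_comp_inl, Sum.elim_comp_inr, map_add,
      d_d_apply, map_smul, smul_neg, zero_add, add_neg_cancel]

lemma cone_exact_add_two (F : GradedFreeResolution I) (g : MvPolynomial (Fin n) K) (i : ℕ) :
    Function.Exact (F.coneDSucc g (i + 1)).mulVecLin (F.coneDSucc g i).mulVecLin := by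
  intro v
  constructor
  · intro hv
    rw [coneDSucc_apply] at hv
    have hv1 : (F.d (i + 1)).mulVecLin (v ∘ Sum.inl) + g • (v ∘ Sum.inr) = 0 :=
      congrArg (· ∘ Sum.inl) hv
    have hv2 : -(F.d i).mulVecLin (v ∘ Sum.inr) = 0 := congrArg (· ∘ Sum.inr) hv
    obtain ⟨w, hw⟩ := (F.exact_succ i _).1 (neg_eq_zero.1 hv2)
    have h2 : (F.d (i + 1)).mulVecLin (v ∘ Sum.inl + g • w) = 0 := by
      rw [map_add, map_smul, hw, hv1]
    obtain ⟨u, hu⟩ := (F.exact_succ (i + 1) _).1 h2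
    refine ⟨Sum.elim u (-w), ?_⟩
    rw [coneDSucc_apply, Sum.elim_comp_inl, Sum.elim_comp_inr, map_neg, neg_neg, hu, hw, smul_neg,
      add_neg_cancel_right]
    exact Sum.elim_comp_inl_inr v
  · rintro ⟨u, rfl⟩
    rw [coneDSucc_apply, coneDSucc_apply, Sum.elim_comp_inl, Sum.elim_comp_inr, map_add,
      d_d_apply, map_smul, smul_neg, zero_add, add_neg_cancel, map_neg, d_d_apply, neg_zero,
      neg_zero]
    exact Sum.elim_zero_zero

lemma cone_exact_zero (F : GradedFreeResolution I) (g : MvPolynomial (Fin n) K) :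
    Function.Exact (F.coneDZero g).mulVecLin
      ((Submodule.factor (le_sup_left : I ≤ I ⊔ Ideal.span {g})) ∘ₗ F.aug) := by
  intro v
  have key : (Submodule.factor (le_sup_left : I ≤ I ⊔ Ideal.span {g})) (F.aug v) = 0 ↔
      ∃ w, F.aug v = g • F.aug w := by
    obtain ⟨x, hx⟩ := Ideal.Quotient.mk_surjective (F.aug v)
    rw [← hx]
    change Ideal.Quotient.mk (I ⊔ Ideal.span {g}) x = 0 ↔ _
    rw [Ideal.Quotient.eq_zero_iff_mem, sup_comm, Ideal.mem_span_singleton_sup]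
    constructor
    · rintro ⟨a, b, hb, rfl⟩
      obtain ⟨w, hw⟩ := F.aug_surjective (Ideal.Quotient.mk I a)
      refine ⟨w, ?_⟩
      rw [hw, map_add, Ideal.Quotient.eq_zero_iff_mem.2 hb, add_zero, mul_comm, map_mul]
      rfl
    · rintro ⟨w, hw⟩
      obtain ⟨a, ha⟩ := Ideal.Quotient.mk_surjective (F.aug w)
      rw [← ha] at hw
      replace hw : Ideal.Quotient.mk I x = Ideal.Quotient.mk I (g * a) := by
        rw [hw, map_mul]
        rfl
      exact ⟨a, x - g * a, Ideal.Quotient.eq.1 hw, by ring⟩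
  rw [LinearMap.comp_apply]
  refine key.trans ⟨?_, ?_⟩
  · rintro ⟨w, hw⟩
    rw [← map_smul, ← sub_eq_zero, ← map_sub] at hw
    obtain ⟨u, hu⟩ := (F.exact_zero _).1 hw
    refine ⟨Sum.elim u w, ?_⟩
    rw [coneDZero_apply, Sum.elim_comp_inl, Sum.elim_comp_inr, hu]
    exact sub_add_cancel _ _
  · rintro ⟨u, rfl⟩
    refine ⟨u ∘ Sum.inr, ?_⟩
    rw [coneDZero_apply, map_add, (F.exact_zero _).2 ⟨_, rfl⟩, zero_add, map_smul]

/-- If `g` is homogeneous of degree `e` and regular on `S ⧸ I`, then the mapping cone of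
multiplication by `g` on a resolution of `S ⧸ I` is a resolution of `S ⧸ (I + (g))`. -/
noncomputable def cone (F : GradedFreeResolution I) {g : MvPolynomial (Fin n) K} {e : ℤ}
    (hg : IsHomogeneousOfDegree g e) (hreg : ∀ x, g * x ∈ I → x ∈ I) :
    GradedFreeResolution (I ⊔ Ideal.span {g}) where
  ι := F.coneι
  fintype_ι := F.fintypeConeι
  decEq_ι := F.decidableEqConeι
  deg := F.coneDeg e
  d := F.coneD g
  aug := (Submodule.factor le_sup_left) ∘ₗ F.aug
  d_homogeneous
    | 0, a, .inl b => F.d_homogeneous 0 a b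
    | 0, a, .inr b => isGradedMatrix_smul_one hg (F.deg _) a b
    | i + 1, .inl a, .inl b => F.d_homogeneous (i + 1) a b
    | i + 1, .inl a, .inr b => isGradedMatrix_smul_one hg (F.deg _) a b
    | i + 1, .inr a, .inl b => isHomogeneousOfDegree_zero _
    | i + 1, .inr a, .inr b => by
      have := IsHomogeneousOfDegree.neg (F.d_homogeneous i a b)
      have h : F.coneDeg e (i + 2) (.inr b) - F.coneDeg e (i + 1) (.inr a) =
          F.deg (i + 1) b - F.deg i a := add_sub_add_right_eq_sub _ _ _
      rw [h]
      exact this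
  aug_homogeneous a := by
    obtain ⟨h, hh, ha⟩ := F.aug_homogeneous a
    refine ⟨h, hh, ?_⟩
    change Submodule.factor le_sup_left (F.aug (Pi.single a 1)) = _
    rw [ha]
    rfl
  aug_surjective := (Submodule.factor_surjective le_sup_left).comp F.aug_surjective
  exact_zero := F.cone_exact_zero g
  exact_succ
    | 0 => F.cone_exact_one hreg
    | i + 1 => F.cone_exact_add_two g i

lemma IsMinimal.cone {F : GradedFreeResolution I} (hF : F.IsMinimal) {g : MvPolynomial (Fin n) K}
    {e : ℤ} (hg : IsHomogeneousOfDegree g e) (hreg : ∀ x, g * x ∈ I → x ∈ I)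
    (h0 : constantCoeff g = 0) : (F.cone hg hreg).IsMinimal
  | 0, a, .inl b => hF 0 a b
  | 0, a, .inr b => by
    change constantCoeff (g * (1 : Matrix (F.ι 0) (F.ι 0) (MvPolynomial (Fin n) K)) a b) = 0
    rw [map_mul, h0, zero_mul]
  | i + 1, .inl a, .inl b => hF (i + 1) a b
  | i + 1, .inl a, .inr b => by
    change constantCoeff (g * (1 : Matrix (F.ι _) (F.ι _) (MvPolynomial (Fin n) K)) a b) = 0
    rw [map_mul, h0, zero_mul]
  | i + 1, .inr a, .inl b => map_zero _
  | i + 1, .inr a, .inr b => by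
    change constantCoeff (-(F.d i a b)) = 0
    rw [map_neg, hF, neg_zero]

lemma card_cone_zero (F : GradedFreeResolution I) {g : MvPolynomial (Fin n) K} {e : ℤ}
    (hg : IsHomogeneousOfDegree g e) (hreg : ∀ x, g * x ∈ I → x ∈ I) (j : ℤ) :
    Fintype.card ((F.cone hg hreg).Idx 0 j) = Fintype.card (F.Idx 0 j) :=
  rfl

lemma card_cone_succ (F : GradedFreeResolution I) {g : MvPolynomial (Fin n) K} {e : ℤ}
    (hg : IsHomogeneousOfDegree g e) (hreg : ∀ x, g * x ∈ I → x ∈ I) (i : ℕ) (j : ℤ) :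
    Fintype.card ((F.cone hg hreg).Idx (i + 1) j) =
      Fintype.card (F.Idx (i + 1) j) + Fintype.card (F.Idx i (j - e)) := by
  have E : (F.cone hg hreg).Idx (i + 1) j ≃ F.Idx (i + 1) j ⊕ F.Idx i (j - e) :=
    (Equiv.subtypeSum (α := F.ι (i + 1)) (β := F.ι i)).trans
      (Equiv.sumCongr (Equiv.refl _) (Equiv.subtypeEquivRight fun a => eq_sub_iff_add_eq.symm))
  rw [Fintype.card_congr E, Fintype.card_sum]

/-- The resolution of `S ⧸ 0` with `F_0 = S` and `F_i = 0` for `i ≥ 1`. -/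
noncomputable def base : GradedFreeResolution (⊥ : Ideal (MvPolynomial (Fin n) K)) where
  ι
    | 0 => Unit
    | _ + 1 => Empty
  fintype_ι
    | 0 => inferInstanceAs (Fintype Unit)
    | _ + 1 => inferInstanceAs (Fintype Empty)
  decEq_ι
    | 0 => inferInstanceAs (DecidableEq Unit)
    | _ + 1 => inferInstanceAs (DecidableEq Empty)
  deg _ _ := 0
  d _ := 0
  aug := (Ideal.Quotient.mkₐ (MvPolynomial (Fin n) K) ⊥).toLinearMap ∘ₗ LinearMap.proj ()
  d_homogeneous _ _ _ := isHomogeneousOfDegree_zero _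
  aug_homogeneous a := ⟨1, isHomogeneousOfDegree_one, by
    cases a
    simp⟩
  aug_surjective x := by
    obtain ⟨y, rfl⟩ := Ideal.Quotient.mk_surjective x
    exact ⟨fun _ => y, rfl⟩
  exact_zero := by
    intro v
    constructor
    · intro hv
      refine ⟨0, ?_⟩
      have : v () = 0 := by simpa [Ideal.Quotient.eq_zero_iff_mem] using hv
      rw [map_zero]
      ext1 x
      exact this.symm
    · rintro ⟨u, rfl⟩
      simp
  exact_succ i := by
    intro v
    have : v = 0 := funext fun x => Empty.elim x
    subst this
    exact ⟨fun _ => ⟨0, map_zero _⟩, fun _ => map_zero _⟩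

end GradedFreeResolution

/-! ### Minimal resolutions of complete intersections -/

/-- An iterated mapping cone (a Koszul complex) is a minimal graded free resolution of a complete
intersection. -/
lemma exists_isMinimal (L : List (MvPolynomial (Fin n) K × ℤ))
    (hhom : ∀ x ∈ L, IsHomogeneousOfDegree x.1 x.2) (h0 : ∀ x ∈ L, constantCoeff x.1 = 0)
    (hreg : RingTheory.Sequence.IsWeaklyRegular (MvPolynomial (Fin n) K) (L.map Prod.fst)) :
    ∃ F : GradedFreeResolution (Ideal.ofList (L.map Prod.fst)), F.IsMinimal ∧
      ∀ i j, Fintype.card (F.Idx i j) =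
        ((Multiset.powersetCard i (L.map Prod.snd : Multiset ℤ)).map Multiset.sum).count j := by
  induction L using List.reverseRecOn with
  | nil =>
    rw [List.map_nil, Ideal.ofList_nil]
    refine ⟨GradedFreeResolution.base, fun _ _ _ => map_zero _, fun i j => ?_⟩
    cases i with
    | zero =>
      rw [Multiset.powersetCard_zero_left, Multiset.map_singleton, Multiset.sum_zero,
        Multiset.count_singleton]
      change Fintype.card {_a : Unit // (0 : ℤ) = j} = _
      split_ifs with h
      · subst h
        simp
      · have : IsEmpty {_a : Unit // (0 : ℤ) = j} := ⟨fun a => h a.2.symm⟩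
        exact Fintype.card_eq_zero
    | succ i =>
      have : IsEmpty ((GradedFreeResolution.base (K := K) (n := n)).Idx (i + 1) j) :=
        ⟨fun a => Empty.elim a.1⟩
      rw [Fintype.card_eq_zero]
      simp
  | append_singleton L x ih =>
    simp only [List.map_append, List.map_cons, List.map_nil] at hreg ⊢
    rw [RingTheory.Sequence.isWeaklyRegular_append_iff,
      RingTheory.Sequence.isWeaklyRegular_singleton_iff] at hreg
    obtain ⟨F, hF, hc⟩ := ih (fun y hy => hhom y (by simp [hy])) (fun y hy => h0 y (by simp [hy]))
      hreg.1
    have hr : ∀ y, x.1 * y ∈ Ideal.ofList (L.map Prod.fst) →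
        y ∈ Ideal.ofList (L.map Prod.fst) := fun y hy => by
      have htop : Ideal.ofList (L.map Prod.fst) • ⊤ = Ideal.ofList (L.map Prod.fst) :=
        Ideal.mul_top _
      have h1 := hreg.2
      rw [htop] at h1
      refine Ideal.Quotient.eq_zero_iff_mem.1 (isSMulRegular_iff_right_eq_zero_of_smul.1 h1 _ ?_)
      exact Ideal.Quotient.eq_zero_iff_mem.2 hy
    have hx := hhom x (by simp)
    have hD : ((L.map Prod.snd ++ [x.2] : List ℤ) : Multiset ℤ) =
        x.2 ::ₘ (L.map Prod.snd : Multiset ℤ) := by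
      rw [← Multiset.coe_add, add_comm]
      rfl
    rw [hD]
    have hJ : Ideal.ofList ((L ++ [x]).map Prod.fst) =
        Ideal.ofList (L.map Prod.fst) ⊔ Ideal.span {x.1} := by
      rw [List.map_append, Ideal.ofList_append, List.map_singleton, Ideal.ofList_singleton]
    rw [hJ]
    refine ⟨F.cone hx hr, hF.cone hx hr (h0 x (by simp)), fun i j => ?_⟩
    cases i with
    | zero =>
      rw [GradedFreeResolution.card_cone_zero, hc]
      simp
    | succ i =>
      rw [GradedFreeResolution.card_cone_succ, hc, hc, Multiset.powersetCard_cons,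
        Multiset.map_add, Multiset.count_add, Multiset.map_map]
      congr 1
      have : (Multiset.sum ∘ Multiset.cons x.2 : Multiset ℤ → ℤ) = (x.2 + ·) ∘ Multiset.sum :=
        funext fun s => Multiset.sum_cons _ _
      rw [this, ← Multiset.map_map]
      conv_rhs => rw [← add_sub_cancel x.2 j]
      rw [Multiset.count_map_eq_count' _ _ (add_right_injective x.2)]

/-! ### Comparison of the bounds for different sequences of shifts -/

lemma eq_of_prod_eq_prod {α : Type*} {s : Finset α} {f g : α → ℚ} (hf : ∀ a ∈ s, 0 < f a)
    (hfg : ∀ a ∈ s, f a ≤ g a) (h : ∏ a ∈ s, f a = ∏ a ∈ s, g a) : ∀ a ∈ s, f a = g a := by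
  by_contra! ⟨a, ha, hne⟩
  exact (Finset.prod_lt_prod hf hfg ⟨a, ha, lt_of_le_of_ne (hfg a ha) hne⟩).ne h

/-- A sequence that is positive and strictly increasing on `{1, …, p}`, such as the minimal or the
maximal shifts. -/
def IsShiftSequence (p : ℕ) (A : ℕ → ℤ) : Prop :=
  (∀ j, 1 ≤ j → j ≤ p → 0 < A j) ∧ ∀ j k, 1 ≤ j → j < k → k ≤ p → A j < A k

section Bounds

variable {p : ℕ} {A B : ℕ → ℤ}

lemma div_sub_le_div_sub {a a' b b' : ℤ} (ha : a < a') (hb : b < b') (h : a * b' ≤ b * a') :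
    (a : ℚ) / ((a' : ℚ) - a) ≤ (b : ℚ) / ((b' : ℚ) - b) := by
  have ha' : (a : ℚ) < a' := by exact_mod_cast ha
  have hb' : (b : ℚ) < b' := by exact_mod_cast hb
  have h' : (a : ℚ) * b' ≤ b * a' := by exact_mod_cast h
  rw [div_le_div_iff₀ (by linarith) (by linarith)]
  linarith

lemma div_sub_le_div_sub' {a a' b b' : ℤ} (ha : a < a') (hb : b < b') (h : a * b' ≤ b * a') :
    (a' : ℚ) / ((a' : ℚ) - a) ≤ (b' : ℚ) / ((b' : ℚ) - b) := by
  have ha' : (a : ℚ) < a' := by exact_mod_cast ha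
  have hb' : (b : ℚ) < b' := by exact_mod_cast hb
  have h' : (a : ℚ) * b' ≤ b * a' := by exact_mod_cast h
  rw [div_le_div_iff₀ (by linarith) (by linarith)]
  linarith

lemma div_sub_pos {a b c : ℤ} (ha : 0 < a) (h : b < c) : (0 : ℚ) < (a : ℚ) / ((c : ℚ) - b) := by
  have ha' : (0 : ℚ) < a := by exact_mod_cast ha
  have h' : (b : ℚ) < c := by exact_mod_cast h
  exact div_pos ha' (by linarith)

/-- The bound `pureBound` is monotone for the order on sequences in which `A` is at most `B` if the
ratios `A_j / B_j` increase with `j`: each factor `A_j / (A_i - A_j)` or `A_j / (A_j - A_i)`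
increases. -/
lemma pureBound_le_pureBound (hA : IsShiftSequence p A) (hB : IsShiftSequence p B)
    (h : ∀ j k, 1 ≤ j → j < k → k ≤ p → A j * B k ≤ B j * A k) {i : ℕ} (hi : 1 ≤ i)
    (hip : i ≤ p) : pureBound A p i ≤ pureBound B p i := by
  unfold pureBound
  have h1 : ∀ j ∈ Finset.Ico 1 i, (0 : ℚ) < (A j : ℚ) / ((A i : ℚ) - (A j : ℚ)) := fun j hj => by
    rw [Finset.mem_Ico] at hj
    exact div_sub_pos (hA.1 j (by omega) (by omega)) (hA.2 j i (by omega) (by omega) (by omega))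
  have h2 : ∀ j ∈ Finset.Ioc i p, (0 : ℚ) < (A j : ℚ) / ((A j : ℚ) - (A i : ℚ)) := fun j hj => by
    rw [Finset.mem_Ioc] at hj
    exact div_sub_pos (hA.1 j (by omega) (by omega)) (hA.2 i j (by omega) (by omega) (by omega))
  have h3 : ∀ j ∈ Finset.Ico 1 i, (A j : ℚ) / ((A i : ℚ) - (A j : ℚ)) ≤
      (B j : ℚ) / ((B i : ℚ) - (B j : ℚ)) := fun j hj => by
    rw [Finset.mem_Ico] at hj
    exact div_sub_le_div_sub (hA.2 j i (by omega) (by omega) (by omega))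
      (hB.2 j i (by omega) (by omega) (by omega)) (h j i (by omega) (by omega) (by omega))
  have h4 : ∀ j ∈ Finset.Ioc i p, (A j : ℚ) / ((A j : ℚ) - (A i : ℚ)) ≤
      (B j : ℚ) / ((B j : ℚ) - (B i : ℚ)) := fun j hj => by
    rw [Finset.mem_Ioc] at hj
    exact div_sub_le_div_sub' (hA.2 i j (by omega) (by omega) (by omega))
      (hB.2 i j (by omega) (by omega) (by omega)) (h i j (by omega) (by omega) (by omega))
  exact mul_le_mul (Finset.prod_le_prod (fun j hj => (h1 j hj).le) h3)
    (Finset.prod_le_prod (fun j hj => (h2 j hj).le) h4)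
    (Finset.prod_nonneg fun j hj => (h2 j hj).le)
    (Finset.prod_nonneg fun j hj => (h1 j hj).le.trans (h3 j hj))

/-- Equality of the two bounds for `i = 1` already makes the sequences proportional. -/
lemma mul_eq_mul_of_pureBound_one_eq (hA : IsShiftSequence p A) (hB : IsShiftSequence p B)
    (h : ∀ j k, 1 ≤ j → j < k → k ≤ p → A j * B k ≤ B j * A k)
    (heq : pureBound A p 1 = pureBound B p 1) {j : ℕ} (hj : 1 ≤ j) (hjp : j ≤ p) :
    A 1 * B j = B 1 * A j := by
  rcases hj.eq_or_lt with rfl | hj1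
  · ring
  simp only [pureBound, Finset.Ico_self, Finset.prod_empty, one_mul] at heq
  have hA' := hA.2 1 j le_rfl hj1 hjp
  have hB' := hB.2 1 j le_rfl hj1 hjp
  have := eq_of_prod_eq_prod (fun k hk => by
    rw [Finset.mem_Ioc] at hk
    exact div_sub_pos (hA.1 k (by omega) (by omega)) (hA.2 1 k (by omega) (by omega) (by omega)))
    (fun k hk => by
      rw [Finset.mem_Ioc] at hk
      exact div_sub_le_div_sub' (hA.2 1 k (by omega) (by omega) (by omega))
        (hB.2 1 k (by omega) (by omega) (by omega)) (h 1 k (by omega) (by omega) (by omega)))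
    heq j (Finset.mem_Ioc.2 ⟨hj1, hjp⟩)
  have hA'' : (A 1 : ℚ) < A j := by exact_mod_cast hA'
  have hB'' : (B 1 : ℚ) < B j := by exact_mod_cast hB'
  rw [div_eq_div_iff (by linarith) (by linarith)] at this
  have h2 : (A 1 : ℚ) * B j = B 1 * A j := by linarith
  exact_mod_cast h2

lemma prod_Ico_cast (i : ℕ) (hi : 1 ≤ i) : ∏ j ∈ Finset.Ico 1 i, (j : ℚ) = (i - 1).factorial := by
  obtain ⟨i, rfl⟩ := Nat.exists_eq_add_of_le' hi
  rw [Nat.add_sub_cancel, ← Finset.prod_Ico_id_eq_factorial, Nat.cast_prod]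

lemma prod_Ico_sub (i : ℕ) (hi : 1 ≤ i) :
    ∏ j ∈ Finset.Ico 1 i, ((i : ℚ) - j) = (i - 1).factorial := by
  rw [← prod_Ico_cast i hi]
  refine Finset.prod_nbij' (i - ·) (i - ·) ?_ ?_ ?_ ?_ ?_ <;> intro j hj <;>
    rw [Finset.mem_Ico] at hj
  · exact Finset.mem_Ico.2 (by omega)
  · exact Finset.mem_Ico.2 (by omega)
  · exact Nat.sub_sub_self hj.2.le
  · exact Nat.sub_sub_self hj.2.le
  · rw [Nat.cast_sub hj.2.le]

lemma prod_Ioc_sub (i p : ℕ) (hip : i ≤ p) :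
    ∏ j ∈ Finset.Ioc i p, ((j : ℚ) - i) = (p - i).factorial := by
  induction p, hip using Nat.le_induction with
  | base => simp
  | succ p hip ih =>
    rw [← Finset.insert_Ioc_right_eq_Ioc_add_one hip, Finset.prod_insert (by simp), ih,
      Nat.succ_sub hip, Nat.factorial_succ]
    push_cast [hip]
    ring

lemma prod_Ioc_cast (i p : ℕ) (hip : i ≤ p) :
    (i.factorial : ℚ) * ∏ j ∈ Finset.Ioc i p, (j : ℚ) = p.factorial := by
  induction p, hip using Nat.le_induction with
  | base => simp
  | succ p hip ih =>
    rw [← Finset.insert_Ioc_right_eq_Ioc_add_one hip, Finset.prod_insert (by simp),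
      Nat.factorial_succ, Nat.cast_mul, ← ih]
    ring

lemma isShiftSequence_natCast : IsShiftSequence p (fun j => (j : ℤ)) :=
  ⟨fun _ hj _ => Int.natCast_pos.2 hj, fun _ _ _ h _ => Int.ofNat_lt.2 h⟩

lemma pureBound_natCast {i : ℕ} (hi : 1 ≤ i) (hip : i ≤ p) :
    pureBound (fun j => (j : ℤ)) p i = p.choose i := by
  simp only [pureBound, Int.cast_natCast]
  rw [Finset.prod_div_distrib, Finset.prod_div_distrib, prod_Ico_cast i hi, prod_Ico_sub i hi,
    prod_Ioc_sub i p hip, Nat.cast_choose ℚ hip, ← prod_Ioc_cast i p hip]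
  have h1 : ((i - 1).factorial : ℚ) ≠ 0 := by positivity
  have h2 : (i.factorial : ℚ) ≠ 0 := by positivity
  have h3 : ((p - i).factorial : ℚ) ≠ 0 := by positivity
  field_simp

lemma factorialUpperBound_eq {i : ℕ} (hi : 1 ≤ i) (hip : i ≤ p) (A : ℕ → ℤ) :
    factorialUpperBound A p i = (∏ j ∈ Finset.Ico 1 i, (A j : ℚ) / ((i : ℚ) - j)) *
      ∏ j ∈ Finset.Ioc i p, (A j : ℚ) / ((j : ℚ) - i) := by
  have h : (Finset.Icc 1 p).erase i = Finset.Ico 1 i ∪ Finset.Ioc i p := by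
    ext j
    simp only [Finset.mem_erase, Finset.mem_Icc, Finset.mem_union, Finset.mem_Ico, Finset.mem_Ioc]
    omega
  have hd : Disjoint (Finset.Ico 1 i) (Finset.Ioc i p) := by
    rw [Finset.disjoint_left]
    intro j
    simp only [Finset.mem_Ico, Finset.mem_Ioc]
    omega
  rw [factorialUpperBound, h, Finset.prod_union hd, Finset.prod_div_distrib,
    Finset.prod_div_distrib, prod_Ico_sub i hi, prod_Ioc_sub i p hip]
  field_simp

lemma div_le_div_sub {a b c : ℤ} {x y : ℕ} (ha : 0 < a) (hxy : x < y) (h : (y : ℤ) - x ≤ c - b) :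
    (a : ℚ) / ((c : ℚ) - b) ≤ (a : ℚ) / ((y : ℚ) - x) := by
  have ha' : (0 : ℚ) < a := by exact_mod_cast ha
  have h1 : (x : ℚ) < y := by exact_mod_cast hxy
  have h2 : (y : ℚ) - x ≤ c - b := by exact_mod_cast h
  exact div_le_div_of_nonneg_left ha'.le (by linarith) h2

lemma pureBound_le_factorialUpperBound (hA : IsShiftSequence p A)
    (h : ∀ j k, 1 ≤ j → j < k → k ≤ p → (k : ℤ) - j ≤ A k - A j) {i : ℕ} (hi : 1 ≤ i)
    (hip : i ≤ p) : pureBound A p i ≤ factorialUpperBound A p i := by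
  rw [factorialUpperBound_eq hi hip, pureBound]
  have h1 : ∀ j ∈ Finset.Ico 1 i, (0 : ℚ) < (A j : ℚ) / ((A i : ℚ) - (A j : ℚ)) := fun j hj => by
    rw [Finset.mem_Ico] at hj
    exact div_sub_pos (hA.1 j (by omega) (by omega)) (hA.2 j i (by omega) (by omega) (by omega))
  have h2 : ∀ j ∈ Finset.Ioc i p, (0 : ℚ) < (A j : ℚ) / ((A j : ℚ) - (A i : ℚ)) := fun j hj => by
    rw [Finset.mem_Ioc] at hj
    exact div_sub_pos (hA.1 j (by omega) (by omega)) (hA.2 i j (by omega) (by omega) (by omega))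
  have h3 : ∀ j ∈ Finset.Ico 1 i, (A j : ℚ) / ((A i : ℚ) - (A j : ℚ)) ≤
      (A j : ℚ) / ((i : ℚ) - j) := fun j hj => by
    rw [Finset.mem_Ico] at hj
    exact div_le_div_sub (hA.1 j (by omega) (by omega)) (by omega)
      (h j i (by omega) (by omega) (by omega))
  have h4 : ∀ j ∈ Finset.Ioc i p, (A j : ℚ) / ((A j : ℚ) - (A i : ℚ)) ≤
      (A j : ℚ) / ((j : ℚ) - i) := fun j hj => by
    rw [Finset.mem_Ioc] at hj
    exact div_le_div_sub (hA.1 j (by omega) (by omega)) (by omega)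
      (h i j (by omega) (by omega) (by omega))
  exact mul_le_mul (Finset.prod_le_prod (fun j hj => (h1 j hj).le) h3)
    (Finset.prod_le_prod (fun j hj => (h2 j hj).le) h4)
    (Finset.prod_nonneg fun j hj => (h2 j hj).le)
    (Finset.prod_nonneg fun j hj => (h1 j hj).le.trans (h3 j hj))

lemma sub_eq_of_pureBound_one_eq_factorialUpperBound (hA : IsShiftSequence p A)
    (h : ∀ j k, 1 ≤ j → j < k → k ≤ p → (k : ℤ) - j ≤ A k - A j)
    (heq : pureBound A p 1 = factorialUpperBound A p 1) {j : ℕ} (hj : 1 ≤ j) (hjp : j ≤ p) :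
    A j = A 1 + (j - 1) := by
  rcases hj.eq_or_lt with rfl | hj1
  · simp
  rw [factorialUpperBound_eq le_rfl (hj.trans hjp)] at heq
  simp only [pureBound, Finset.Ico_self, Finset.prod_empty, one_mul] at heq
  have := eq_of_prod_eq_prod (fun k hk => by
    rw [Finset.mem_Ioc] at hk
    exact div_sub_pos (hA.1 k (by omega) (by omega)) (hA.2 1 k (by omega) (by omega) (by omega)))
    (fun k hk => by
      rw [Finset.mem_Ioc] at hk
      exact div_le_div_sub (hA.1 k (by omega) (by omega)) (by omega)
        (h 1 k (by omega) (by omega) (by omega)))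
    heq j (Finset.mem_Ioc.2 ⟨hj1, hjp⟩)
  have hA'' : (A 1 : ℚ) < A j := by exact_mod_cast hA.2 1 j le_rfl hj1 hjp
  have hj2 : ((1 : ℕ) : ℚ) < j := by exact_mod_cast hj1
  have hpos : (0 : ℚ) < A j := by exact_mod_cast hA.1 j hj hjp
  rw [div_eq_div_iff (by linarith) (by linarith)] at this
  have h2 := mul_left_cancel₀ hpos.ne' this
  have h3 : (A j : ℚ) = A 1 + (j - 1) := by push_cast at h2; linarith
  exact_mod_cast h3

lemma factorialUpperBound_eq_pureBound {i : ℕ} (hi : 1 ≤ i) (hip : i ≤ p)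
    (h : ∀ j, 1 ≤ j → j ≤ p → A j = A 1 + (j - 1)) :
    factorialUpperBound A p i = pureBound A p i := by
  rw [factorialUpperBound_eq hi hip, pureBound]
  congr 1 <;> refine Finset.prod_congr rfl fun j hj => ?_
  · rw [Finset.mem_Ico] at hj
    have h1 := h i hi hip
    have h2 := h j (by omega) (by omega)
    rw [show (A i : ℚ) - A j = i - j by rw [h1, h2]; push_cast; ring]
  · rw [Finset.mem_Ioc] at hj
    have h1 := h i hi hip
    have h2 := h j (by omega) (by omega)
    rw [show (A j : ℚ) - A i = j - i by rw [h1, h2]; push_cast; ring]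

lemma quasiPureLowerBound_le_pureBound (hA : IsShiftSequence p A)
    (h : ∀ j, 1 ≤ j → j ≤ p → A j ≤ B j) {i : ℕ} (hi : 1 ≤ i) (hip : i ≤ p) :
    quasiPureLowerBound A B p i ≤ pureBound A p i := by
  rw [quasiPureLowerBound, pureBound]
  have key (j k l : ℕ) (hl : 1 ≤ l) (hlp : l ≤ p) (hj : 1 ≤ j) (hjk : j < k) (hk : k ≤ p) :
      0 ≤ (A l : ℚ) / ((B k : ℚ) - A j) ∧
        (A l : ℚ) / ((B k : ℚ) - A j) ≤ (A l : ℚ) / ((A k : ℚ) - A j) := by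
    have h1 := hA.2 j k hj hjk hk
    have h2 := h k (by omega) hk
    refine ⟨(div_sub_pos (hA.1 l hl hlp) (by omega)).le, ?_⟩
    have h0 : (0 : ℚ) < A l := by exact_mod_cast hA.1 l hl hlp
    have h1' : (A j : ℚ) < A k := by exact_mod_cast h1
    have h2' : (A k : ℚ) ≤ B k := by exact_mod_cast h2
    exact div_le_div_of_nonneg_left h0.le (by linarith) (by linarith)
  have h1 : ∀ j ∈ Finset.Ico 1 i, _ := fun j hj => by
    rw [Finset.mem_Ico] at hj
    exact key j i j (by omega) (by omega) (by omega) (by omega) (by omega)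
  have h2 : ∀ j ∈ Finset.Ioc i p, _ := fun j hj => by
    rw [Finset.mem_Ioc] at hj
    exact key i j j (by omega) (by omega) (by omega) (by omega) (by omega)
  exact mul_le_mul (Finset.prod_le_prod (fun j hj => (h1 j hj).1) fun j hj => (h1 j hj).2)
    (Finset.prod_le_prod (fun j hj => (h2 j hj).1) fun j hj => (h2 j hj).2)
    (Finset.prod_nonneg fun j hj => (h2 j hj).1)
    (Finset.prod_nonneg fun j hj => (h1 j hj).1.trans (h1 j hj).2)

lemma quasiPureLowerBound_eq_pureBound (h : ∀ j, 1 ≤ j → j ≤ p → A j = B j) {i : ℕ} (hi : 1 ≤ i)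
    (hip : i ≤ p) : quasiPureLowerBound A B p i = pureBound A p i := by
  rw [quasiPureLowerBound, pureBound]
  congr 1 <;> refine Finset.prod_congr rfl fun j hj => ?_
  · rw [h i hi hip]
  · rw [Finset.mem_Ioc] at hj
    rw [h j (by omega) (by omega)]

end Bounds

/-! ### Subset sums -/

/-- The sums of the `i`-element subfamilies of the family `d`. -/
def subsetSums {p : ℕ} (d : Fin p → ℤ) (i : ℕ) : Set ℤ :=
  {j | ∃ s : Finset (Fin p), s.card = i ∧ ∑ k ∈ s, d k = j}

section SubsetSums

variable {p : ℕ} {d : Fin p → ℤ} {M m : ℕ → ℤ}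

/-- Averaging over the `i`-element subsets of an `(i + 1)`-element set. -/
lemma mul_sum_le_of_forall_sum_le (d : Fin p → ℤ) {i : ℕ} {x : ℤ}
    (hx : ∀ s : Finset (Fin p), s.card = i → ∑ k ∈ s, d k ≤ x) {s : Finset (Fin p)}
    (hs : s.card = i + 1) : i * ∑ k ∈ s, d k ≤ (i + 1) * x := by
  have h1 : ∑ k ∈ s, ∑ l ∈ s.erase k, d l ≤ ∑ k ∈ s, x :=
    Finset.sum_le_sum fun k hk => hx _ (by rw [Finset.card_erase_of_mem hk, hs, Nat.add_sub_cancel])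
  have h2 : ∑ k ∈ s, ∑ l ∈ s.erase k, d l = ∑ k ∈ s, (∑ l ∈ s, d l - d k) :=
    Finset.sum_congr rfl fun k hk => Finset.sum_erase_eq_sub hk
  rw [h2, Finset.sum_sub_distrib, Finset.sum_const, Finset.sum_const, hs] at h1
  simp only [nsmul_eq_mul, Nat.cast_add, Nat.cast_one] at h1
  linarith

/-- From consecutive indices to all pairs: a discrete form of "`A_j / j` is antitone". -/
lemma mul_le_mul_of_forall_succ {A : ℕ → ℤ}
    (h : ∀ i, 1 ≤ i → i < p → i * A (i + 1) ≤ (i + 1) * A i) (j k : ℕ) (hj : 1 ≤ j) (hjk : j ≤ k)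
    (hk : k ≤ p) : j * A k ≤ k * A j := by
  induction k, hjk using Nat.le_induction with
  | base => exact le_rfl
  | succ k hjk ih =>
    have h1 := h k (by omega) (by omega)
    have h2 := ih (by omega)
    have hk0 : (0 : ℤ) < k := by exact_mod_cast (by omega : 0 < k)
    push_cast
    refine le_of_mul_le_mul_left (a := (k : ℤ)) ?_ hk0
    nlinarith

lemma sub_le_sub_of_forall_succ {A : ℕ → ℤ} (h : ∀ i, i < p → A i + 1 ≤ A (i + 1)) (j k : ℕ)
    (hjk : j ≤ k) (hk : k ≤ p) : (k : ℤ) - j ≤ A k - A j := by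
  induction k, hjk using Nat.le_induction with
  | base => simp
  | succ k hjk ih =>
    have h1 := h k (by omega)
    have h2 := ih (by omega)
    push_cast
    linarith

lemma subsetSums_zero (d : Fin p → ℤ) : subsetSums d 0 = {0} := by
  ext j
  simp [subsetSums, eq_comm]

lemma isShiftSequence_of_sub_le (h0 : M 0 = 0)
    (h : ∀ j k, j ≤ k → k ≤ p → (k : ℤ) - j ≤ M k - M j) : IsShiftSequence p M := by
  refine ⟨fun j hj hjp => ?_, fun j k hj hjk hk => ?_⟩
  · have := h 0 j (by omega) hjp
    rw [h0] at this
    omega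
  · have := h j k hjk.le hk
    omega

lemma sub_le_sub_of_isGreatest (hd : ∀ k, 1 ≤ d k)
    (hM : ∀ i ≤ p, IsGreatest (subsetSums d i) (M i)) (j k : ℕ) (hjk : j ≤ k) (hk : k ≤ p) :
    (k : ℤ) - j ≤ M k - M j := by
  refine sub_le_sub_of_forall_succ (p := p) (fun i hi => ?_) j k hjk hk
  obtain ⟨s, hs, hsum⟩ := (hM i hi.le).1
  obtain ⟨a, ha⟩ : ∃ a, a ∉ s := by
    by_contra! h
    have := (Finset.card_eq_iff_eq_univ s).2 (Finset.eq_univ_iff_forall.2 h)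
    rw [Fintype.card_fin] at this
    omega
  have := (hM (i + 1) hi).2 ⟨insert a s, by rw [Finset.card_insert_of_notMem ha, hs], rfl⟩
  rw [Finset.sum_insert ha, hsum] at this
  linarith [hd a]

lemma sub_le_sub_of_isLeast (hd : ∀ k, 1 ≤ d k)
    (hm : ∀ i ≤ p, IsLeast (subsetSums d i) (m i)) (j k : ℕ) (hjk : j ≤ k) (hk : k ≤ p) :
    (k : ℤ) - j ≤ m k - m j := by
  refine sub_le_sub_of_forall_succ (p := p) (fun i hi => ?_) j k hjk hk
  obtain ⟨s, hs, hsum⟩ := (hm (i + 1) hi).1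
  obtain ⟨a, ha⟩ := Finset.card_pos.1 (by omega : 0 < s.card)
  have := (hm i hi.le).2 ⟨s.erase a, by rw [Finset.card_erase_of_mem ha, hs]; rfl, rfl⟩
  rw [Finset.sum_erase_eq_sub ha, hsum] at this
  linarith [hd a]

/-- `M_j / j` is antitone. -/
lemma mul_le_mul_of_isGreatest (hM : ∀ i ≤ p, IsGreatest (subsetSums d i) (M i)) (j k : ℕ)
    (hj : 1 ≤ j) (hjk : j ≤ k) (hk : k ≤ p) : j * M k ≤ k * M j := by
  refine mul_le_mul_of_forall_succ (fun i _ hi => ?_) j k hj hjk hk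
  obtain ⟨s, hs, hsum⟩ := (hM (i + 1) hi).1
  rw [← hsum]
  exact mul_sum_le_of_forall_sum_le d (fun t ht => (hM i hi.le).2 ⟨t, ht, rfl⟩) hs

/-- `m_j / j` is monotone. -/
lemma mul_le_mul_of_isLeast (hm : ∀ i ≤ p, IsLeast (subsetSums d i) (m i)) (j k : ℕ)
    (hj : 1 ≤ j) (hjk : j ≤ k) (hk : k ≤ p) : k * m j ≤ j * m k := by
  have := mul_le_mul_of_forall_succ (A := fun i => -m i) (p := p) (fun i _ hi => ?_) j k hj hjk hk
  · simp only [mul_neg, neg_le_neg_iff] at this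
    exact this
  · obtain ⟨s, hs, hsum⟩ := (hm (i + 1) hi).1
    have := mul_sum_le_of_forall_sum_le (fun k => -d k) (x := -m i) (i := i) (fun t ht => by
      rw [Finset.sum_neg_distrib, neg_le_neg_iff]
      exact (hm i hi.le).2 ⟨t, ht, rfl⟩) hs
    rwa [Finset.sum_neg_distrib, hsum] at this

lemma mem_subsetSums_one (d : Fin p → ℤ) (k : Fin p) : d k ∈ subsetSums d 1 :=
  ⟨{k}, by simp, by simp⟩

lemma eq_of_mem_subsetSums_card {j : ℤ} (hj : j ∈ subsetSums d p) : j = ∑ k, d k := by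
  obtain ⟨s, hs, rfl⟩ := hj
  rw [(Finset.card_eq_iff_eq_univ s).1 (by rw [hs, Fintype.card_fin])]

/-- If the sum of all `p` entries of `d` is `p` times the largest entry, then `d` is constant. -/
lemma forall_eq_of_isGreatest (hM : ∀ i ≤ p, IsGreatest (subsetSums d i) (M i))
    (h : M p = p * M 1) (k : Fin p) : d k = M 1 := by
  have hp : 1 ≤ p := by have := k.2; omega
  have h1 : ∀ k ∈ Finset.univ, d k ≤ M 1 := fun k _ => (hM 1 hp).2 (mem_subsetSums_one d k)
  refine (Finset.sum_eq_sum_iff_of_le h1).1 ?_ k (Finset.mem_univ k)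
  rw [← eq_of_mem_subsetSums_card (hM p le_rfl).1, h]
  simp

lemma forall_eq_of_isLeast (hm : ∀ i ≤ p, IsLeast (subsetSums d i) (m i))
    (h : m p = p * m 1) (k : Fin p) : d k = m 1 := by
  have hp : 1 ≤ p := by have := k.2; omega
  have h1 : ∀ k ∈ Finset.univ, m 1 ≤ d k := fun k _ => (hm 1 hp).2 (mem_subsetSums_one d k)
  refine ((Finset.sum_eq_sum_iff_of_le h1).1 ?_ k (Finset.mem_univ k)).symm
  rw [← eq_of_mem_subsetSums_card (hm p le_rfl).1, h]
  simp

lemma eq_mul_of_mem_subsetSums {c : ℤ} (hd : ∀ k, d k = c) {i : ℕ} {j : ℤ}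
    (hj : j ∈ subsetSums d i) : j = i * c := by
  obtain ⟨s, rfl, rfl⟩ := hj
  simp [hd]

lemma finite_subsetSums (d : Fin p → ℤ) (i : ℕ) : (subsetSums d i).Finite :=
  (Set.finite_range fun s : Finset (Fin p) => ∑ k ∈ s, d k).subset fun _ ⟨s, _, hs⟩ => ⟨s, hs⟩

lemma subsetSums_nonempty (d : Fin p → ℤ) {i : ℕ} (hi : i ≤ p) : (subsetSums d i).Nonempty := by
  obtain ⟨s, -, hs⟩ := Finset.exists_subset_card_eq
    (s := (Finset.univ : Finset (Fin p))) (n := i) (by simpa using hi)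
  exact ⟨_, s, hs, rfl⟩

end SubsetSums

/-! ### The Betti numbers of a complete intersection -/

section CompleteIntersection

variable {p : ℕ} {f : Fin p → MvPolynomial (Fin n) K} {d : Fin p → ℕ}

/-- An element of degree `0` of a regular sequence would be `0` or a unit. -/
lemma degree_pos_of_isRegular (hhom : ∀ k, (f k).IsHomogeneous (d k))
    (hreg : RingTheory.Sequence.IsRegular (MvPolynomial (Fin n) K) (List.ofFn f)) (k : Fin p) :
    0 < d k := by
  by_contra h0
  have hc : f k = C (coeff 0 (f k)) := by
    rw [← totalDegree_eq_zero_iff_eq_C]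
    have := (hhom k).totalDegree_le
    omega
  by_cases hz : coeff 0 (f k) = 0
  · -- `0` is regular only on the zero module
    rw [hz, map_zero] at hc
    have h1 := hreg.regular_mod_prev k (by simp)
    rw [List.getElem_ofFn, hc] at h1
    have hsub : (⊤ : Submodule (MvPolynomial (Fin n) K) (MvPolynomial (Fin n) K)) ≤
        Ideal.ofList ((List.ofFn f).take k) • ⊤ :=
      (Submodule.Quotient.subsingleton_iff.1 h1.subsingleton).ge
    have hle : Ideal.ofList ((List.ofFn f).take k) ≤ Ideal.ofList (List.ofFn f) :=
      Ideal.span_mono fun r hr => List.mem_of_mem_take hr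
    exact hreg.top_ne_smul (top_unique (hsub.trans (Submodule.smul_mono_left hle))).symm
  · refine hreg.top_ne_smul ?_
    have : Ideal.ofList (List.ofFn f) = ⊤ := by
      refine Ideal.eq_top_of_isUnit_mem _ (Ideal.subset_span (a := f k) ?_) ?_
      · exact (List.mem_ofFn' f _).2 ⟨k, rfl⟩
      · rw [hc]
        exact (isUnit_iff_ne_zero.2 hz).map C
    rw [this]
    exact (Ideal.mul_top ⊤).symm

lemma isHomogeneousOfDegree_of_isHomogeneous {g : MvPolynomial (Fin n) K} {e : ℕ}
    (hg : g.IsHomogeneous e) : IsHomogeneousOfDegree g e := by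
  intro m hm
  rw [Nat.cast_inj, ← hg (mem_support_iff.1 hm), Finsupp.degree_eq_weight_one]
  rfl

/-- `β_{i,j}` is the number of `i`-element sets of generators whose degrees sum to `j`. -/
lemma gradedBetti_eq_count (hhom : ∀ k, (f k).IsHomogeneous (d k))
    (hreg : RingTheory.Sequence.IsRegular (MvPolynomial (Fin n) K) (List.ofFn f)) (i : ℕ) (j : ℤ) :
    gradedBetti (Ideal.span (Set.range f)) i j =
      ((Finset.powersetCard i Finset.univ).val.map
        fun s : Finset (Fin p) => ∑ k ∈ s, (d k : ℤ)).count j := by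
  have hf (k : Fin p) := isHomogeneousOfDegree_of_isHomogeneous (hhom k)
  let L : List (MvPolynomial (Fin n) K × ℤ) := List.ofFn fun k => (f k, (d k : ℤ))
  have hL1 : L.map Prod.fst = List.ofFn f := List.map_ofFn
  have hL2 : ((L.map Prod.snd : List ℤ) : Multiset ℤ) =
      (Finset.univ : Finset (Fin p)).val.map fun k => (d k : ℤ) := by
    rw [Fin.univ_val_map]
    congr 1
    exact List.map_ofFn
  have hJ : Ideal.ofList (L.map Prod.fst) = Ideal.span (Set.range f) := by
    rw [hL1, Ideal.ofList]
    congr 1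
    ext r
    exact List.mem_ofFn' f r
  obtain ⟨F, hF, hc⟩ := exists_isMinimal L
    (fun x hx => by
      obtain ⟨k, rfl⟩ := (List.mem_ofFn' _ _).1 hx
      exact hf k)
    (fun x hx => by
      obtain ⟨k, rfl⟩ := (List.mem_ofFn' _ _).1 hx
      by_contra h
      have h1 := hf k 0 (mem_support_iff.2 h)
      have h2 := degree_pos_of_isRegular hhom hreg k
      simp only [map_zero, Nat.cast_zero] at h1
      omega)
    (hL1 ▸ hreg.toIsWeaklyRegular)
  have hgr : ∀ g ∈ Ideal.ofList (L.map Prod.fst), ∀ e,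
      intComponent e g ∈ Ideal.ofList (L.map Prod.fst) := by
    rw [hJ]
    exact fun g hg e => intComponent_mem_span hf hg e
  rw [← hJ, gradedBetti_eq_torDim hgr F, hF.torDim_eq, hc, hL2, Multiset.powersetCard_map,
    ← Finset.map_val_val_powersetCard, Multiset.map_map, Multiset.map_map]
  rfl

lemma shifts_eq_subsetSums (hhom : ∀ k, (f k).IsHomogeneous (d k))
    (hreg : RingTheory.Sequence.IsRegular (MvPolynomial (Fin n) K) (List.ofFn f)) (i : ℕ) :
    shifts (Ideal.span (Set.range f)) i = subsetSums (fun k => (d k : ℤ)) i := by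
  ext j
  rw [shifts, Set.mem_ofPred_eq, gradedBetti_eq_count hhom hreg, Multiset.count_ne_zero,
    Multiset.mem_map]
  simp [subsetSums, Finset.mem_powersetCard]

lemma totalBetti_eq_choose (hhom : ∀ k, (f k).IsHomogeneous (d k))
    (hreg : RingTheory.Sequence.IsRegular (MvPolynomial (Fin n) K) (List.ofFn f)) (i : ℕ) :
    totalBetti (Ideal.span (Set.range f)) i = p.choose i := by
  simp only [totalBetti, gradedBetti_eq_count hhom hreg]
  rw [finsum_eq_sum_of_support_subset (s := Multiset.toFinset _) _ fun j hj =>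
      Multiset.mem_toFinset.2 (Multiset.count_ne_zero.1 hj),
    Multiset.toFinset_sum_count_eq, Multiset.card_map, Finset.card_val, Finset.card_powersetCard,
    Finset.card_univ, Fintype.card_fin]

end CompleteIntersection

end BettiCI

open BettiCI in
theorem theorem2p1 {K : Type*} [Field K] {n p : ℕ}
    (f : Fin p → MvPolynomial (Fin n) K) (d : Fin p → ℕ)
    (hhom : ∀ k, (f k).IsHomogeneous (d k))
    (hreg : RingTheory.Sequence.IsRegular (MvPolynomial (Fin n) K) (List.ofFn f))
    (I : Ideal (MvPolynomial (Fin n) K)) (hI : I = Ideal.span (Set.range f)) :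
    -- the Betti numbers
    (∀ i, (shifts I i).Finite ∧ totalBetti I i = p.choose i) ∧
    -- upper bounds
    (∀ i, 1 ≤ i → i ≤ p →
      (totalBetti I i : ℚ) ≤ pureBound (maxShift I) p i ∧
      pureBound (maxShift I) p i ≤ factorialUpperBound (maxShift I) p i) ∧
    ((∀ i, 1 ≤ i → i ≤ p → (totalBetti I i : ℚ) = pureBound (maxShift I) p i) ↔
      HasPureResolution I) ∧
    ((∀ i, 1 ≤ i → i ≤ p →
      (totalBetti I i : ℚ) = pureBound (maxShift I) p i ∧
      (totalBetti I i : ℚ) = factorialUpperBound (maxShift I) p i) ↔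
      HasLinearResolution I) ∧
    -- lower bounds
    (∀ i, 1 ≤ i → i ≤ p →
      pureBound (minShift I) p i ≤ (totalBetti I i : ℚ) ∧
      quasiPureLowerBound (minShift I) (maxShift I) p i ≤ pureBound (minShift I) p i) ∧
    ((∀ i, 1 ≤ i → i ≤ p → (totalBetti I i : ℚ) = pureBound (minShift I) p i) ↔
      HasPureResolution I) ∧
    ((∀ i, 1 ≤ i → i ≤ p →
      (totalBetti I i : ℚ) = quasiPureLowerBound (minShift I) (maxShift I) p i) ↔
      HasPureResolution I) ∧
    -- purity in terms of the degrees of the generators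
    (HasPureResolution I ↔ ∀ k l, d k = d l) := by
  subst hI
  have hS := shifts_eq_subsetSums hhom hreg
  have hβ := totalBetti_eq_choose hhom hreg
  set I := Ideal.span (Set.range f)
  set D : Fin p → ℤ := fun k => (d k : ℤ) with hD
  have hd : ∀ k, 1 ≤ D k := fun k => by
    have := degree_pos_of_isRegular hhom hreg k
    simp only [hD]
    omega
  have hM : ∀ i ≤ p, IsGreatest (subsetSums D i) (maxShift I i) := fun i hi => by
    rw [maxShift, hS]
    exact ⟨(subsetSums_nonempty D hi).csSup_mem (finite_subsetSums D i),
      fun x hx => le_csSup (finite_subsetSums D i).bddAbove hx⟩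
  have hm : ∀ i ≤ p, IsLeast (subsetSums D i) (minShift I i) := fun i hi => by
    rw [minShift, hS]
    exact ⟨(subsetSums_nonempty D hi).csInf_mem (finite_subsetSums D i),
      fun x hx => csInf_le (finite_subsetSums D i).bddBelow hx⟩
  have hM0 : maxShift I 0 = 0 := by simpa [subsetSums_zero] using (hM 0 (Nat.zero_le p)).1
  have hm0 : minShift I 0 = 0 := by simpa [subsetSums_zero] using (hm 0 (Nat.zero_le p)).1
  have hMsub := sub_le_sub_of_isGreatest hd hM
  have hMs := isShiftSequence_of_sub_le hM0 hMsub
  have hms := isShiftSequence_of_sub_le hm0 (sub_le_sub_of_isLeast hd hm)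
  have hMavg := mul_le_mul_of_isGreatest hM
  have hmavg := mul_le_mul_of_isLeast hm
  have hmM : ∀ j, 1 ≤ j → j ≤ p → minShift I j ≤ maxShift I j := fun j _ hj =>
    (hm j hj).2 (hM j hj).1
  have hβ' (i : ℕ) (hi : 1 ≤ i) (hip : i ≤ p) :
      (totalBetti I i : ℚ) = pureBound (fun j => (j : ℤ)) p i := by
    rw [hβ, pureBound_natCast hi hip]
  have hcmpM : ∀ j k : ℕ, 1 ≤ j → j < k → k ≤ p →
      (j : ℤ) * maxShift I k ≤ maxShift I j * (k : ℤ) := fun j k hj hjk hk => by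
    rw [mul_comm (maxShift I j)]
    exact hMavg j k hj hjk.le hk
  have hcmpm : ∀ j k : ℕ, 1 ≤ j → j < k → k ≤ p →
      minShift I j * (k : ℤ) ≤ (j : ℤ) * minShift I k := fun j k hj hjk hk => by
    rw [mul_comm (minShift I j)]
    exact hmavg j k hj hjk.le hk
  -- the two inequalities that compare `β_i` with the bounds
  have hup (i : ℕ) (hi : 1 ≤ i) (hip : i ≤ p) :
      (totalBetti I i : ℚ) ≤ pureBound (maxShift I) p i := by
    rw [hβ' i hi hip]
    exact pureBound_le_pureBound isShiftSequence_natCast hMs hcmpM hi hip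
  have hlow (i : ℕ) (hi : 1 ≤ i) (hip : i ≤ p) :
      pureBound (minShift I) p i ≤ (totalBetti I i : ℚ) := by
    rw [hβ' i hi hip]
    exact pureBound_le_pureBound hms isShiftSequence_natCast hcmpm hi hip
  have hquasi (i : ℕ) (hi : 1 ≤ i) (hip : i ≤ p) :=
    quasiPureLowerBound_le_pureBound hms hmM hi hip
  have hpure : HasPureResolution I ↔ ∀ k l, d k = d l := by
    constructor
    · rintro ⟨e, he⟩ k l
      have h1 (k : Fin p) : D k = e 1 := he 1 le_rfl _ (by
        rw [hS]
        exact mem_subsetSums_one D k)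
      exact Int.ofNat_inj.1 ((h1 k).trans (h1 l).symm)
    · intro h
      rcases Nat.eq_zero_or_pos p with rfl | hp
      · refine ⟨fun _ => 0, fun i hi j hj => ?_⟩
        rw [hS] at hj
        simpa using eq_mul_of_mem_subsetSums (c := 0) (fun k => k.elim0) hj
      · refine ⟨fun i => i * D ⟨0, hp⟩, fun i hi j hj => ?_⟩
        rw [hS] at hj
        exact eq_mul_of_mem_subsetSums (fun k => congrArg Nat.cast (h k _)) hj
  -- in the pure case all the degrees equal one number `c`, and `M_i = m_i = i c`
  have hpure_mul (h : HasPureResolution I) :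
      ∃ c, ∀ i ≤ p, maxShift I i = i * c ∧ minShift I i = i * c := by
    rcases Nat.eq_zero_or_pos p with rfl | hp
    · refine ⟨0, fun i hi => ?_⟩
      obtain rfl : i = 0 := by omega
      simp [hM0, hm0]
    · have hc (k : Fin p) : D k = D ⟨0, hp⟩ := congrArg Nat.cast (hpure.1 h k _)
      exact ⟨_, fun i hi => ⟨eq_mul_of_mem_subsetSums hc (hM i hi).1,
        eq_mul_of_mem_subsetSums hc (hm i hi).1⟩⟩
  have hup_eq : (∀ i, 1 ≤ i → i ≤ p → (totalBetti I i : ℚ) = pureBound (maxShift I) p i) ↔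
      HasPureResolution I := by
    constructor
    · intro h
      rw [hpure]
      intro k l
      have hp : 1 ≤ p := by have := k.2; omega
      have h1 := mul_eq_mul_of_pureBound_one_eq isShiftSequence_natCast hMs hcmpM
        (by rw [← hβ' 1 le_rfl hp, h 1 le_rfl hp]) hp le_rfl
      have h2 := forall_eq_of_isGreatest hM (by rw [mul_comm]; simpa using h1)
      exact Int.ofNat_inj.1 ((h2 k).trans (h2 l).symm)
    · intro h i hi hip
      obtain ⟨c, hc⟩ := hpure_mul h
      refine le_antisymm (hup i hi hip) ?_
      rw [hβ' i hi hip]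
      refine pureBound_le_pureBound hMs isShiftSequence_natCast (fun j k hj hjk hk => ?_) hi hip
      rw [(hc j (by omega)).1, (hc k hk).1]
      exact le_of_eq (by ring)
  have hlow_eq : (∀ i, 1 ≤ i → i ≤ p → (totalBetti I i : ℚ) = pureBound (minShift I) p i) ↔
      HasPureResolution I := by
    constructor
    · intro h
      rw [hpure]
      intro k l
      have hp : 1 ≤ p := by have := k.2; omega
      have h1 := mul_eq_mul_of_pureBound_one_eq hms isShiftSequence_natCast hcmpm
        (by rw [← hβ' 1 le_rfl hp, h 1 le_rfl hp]) hp le_rfl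
      have h2 := forall_eq_of_isLeast hm (by rw [mul_comm]; simpa using h1.symm)
      exact Int.ofNat_inj.1 ((h2 k).trans (h2 l).symm)
    · intro h i hi hip
      obtain ⟨c, hc⟩ := hpure_mul h
      refine le_antisymm ?_ (hlow i hi hip)
      rw [hβ' i hi hip]
      refine pureBound_le_pureBound isShiftSequence_natCast hms (fun j k hj hjk hk => ?_) hi hip
      rw [(hc j (by omega)).2, (hc k hk).2]
      exact le_of_eq (by ring)
  have hfac (i : ℕ) (hi : 1 ≤ i) (hip : i ≤ p) :=
    pureBound_le_factorialUpperBound hMs (fun j k _ hjk hk => hMsub j k hjk.le hk) hi hip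
  refine ⟨fun i => ⟨?_, hβ i⟩, fun i hi hip => ⟨hup i hi hip, hfac i hi hip⟩, hup_eq, ?_,
    fun i hi hip => ⟨hlow i hi hip, hquasi i hi hip⟩, hlow_eq, ?_, hpure⟩
  · rw [hS]
    exact finite_subsetSums D i
  · constructor
    · intro h
      obtain ⟨e, he⟩ := hup_eq.1 fun i hi hip => (h i hi hip).1
      refine ⟨maxShift I 1, fun i hi j hj => ?_⟩
      have hip : i ≤ p := by
        rw [hS] at hj
        obtain ⟨s, rfl, -⟩ := hj
        simpa using s.card_le_univ
      -- equality of both bounds for `i = 1` forces `M_j - M_1 = j - 1`, and purity `j = M_i`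
      have h1 := h 1 le_rfl (hi.trans hip)
      rw [← sub_eq_of_pureBound_one_eq_factorialUpperBound hMs
        (fun j k _ hjk hk => hMsub j k hjk.le hk) (h1.1.symm.trans h1.2) hi hip, he i hi j hj,
        he i hi (maxShift I i) (by rw [hS]; exact (hM i hip).1)]
    · rintro ⟨k, hk⟩ i hi hip
      have hpu : HasPureResolution I := ⟨_, hk⟩
      have h1 := hup_eq.2 hpu i hi hip
      refine ⟨h1, h1.trans (factorialUpperBound_eq_pureBound hi hip fun j hj hjp => ?_).symm⟩
      have hmem (j : ℕ) (hj : j ≤ p) : maxShift I j ∈ shifts I j := by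
        rw [hS]
        exact (hM j hj).1
      rw [hk j hj _ (hmem j hjp), hk 1 le_rfl _ (hmem 1 (hj.trans hjp))]
      simp
  · constructor
    · intro h
      exact hlow_eq.1 fun i hi hip =>
        le_antisymm ((h i hi hip).le.trans (hquasi i hi hip)) (hlow i hi hip)
    · intro h i hi hip
      obtain ⟨c, hc⟩ := hpure_mul h
      rw [quasiPureLowerBound_eq_pureBound
        (fun j _ hj => (hc j hj).2.trans (hc j hj).1.symm) hi hip]
      exact hlow_eq.2 h i hi hip
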